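/- Conventions. Let $G$ be a small category; $G$-categories, $G$-cubical sets and $G$-streams are functors from $G$ to small categories, cubical sets and streams, and morphisms between them are natural transformations. The cube category $\square$ has objects the posets $[1]^n$ ($n\geq 0$, $[1]=\{0<1\}$) and morphisms the composites of cofaces, codegeneracies and coordinate permutations; a cubical set is a presheaf on $\square$. The cubical nerve $\mathrm{ner}\,A$ of a small category $A$ has as $n$-cubes the functors $[1]^n\to A$. A stream is a (weak Hausdorff k-)space with a circulation, that is, a preorder $\leqslant_U$ on each open set $U$ such that the preorder of a union of open sets is the smallest preorder containing the preorders of the members; a stream map is a continuous $f$ with $f(x)\leqslant_V f(y)$ whenever $x\leqslant_{f^{-1}V}y$. The directed realization $|C|$ of a cubical set $C$ is the colimit in streams of directed cubes $\vec{\mathbb I}^n$ over the cubes of $C$. Nerves and realizations of $G$-diagrams are taken objectwise. Homotopies. A homotopy $f\rightsquigarrow g$ is: for $G$-functors $A\to B$, a $G$-functor $A\times[1]\to B$ from $f$ to $g$ (a natural transformation compatible with $G$); for $G$-cubical functions $A\to B$, a $G$-cubical function $A\otimes\square[1]\to B$ from $f$ to $g$; for $G$-stream maps $X\to Y$, a $G$-stream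 map $X\times\vec{\mathbb I}\to Y$ from $f$ to $g$. In each case write $f\sim g$ if $f$ and $g$ are joined by a finite zig-zag of homotopies, and call $f:X\to Y$ an equivalence if there is $g:Y\to X$ with $gf\sim 1_X$ and $fg\sim 1_Y$. These are called $\mathrm T_1\mathfrak d_*$-equivalences, $\mathfrak d_*$-equivalences (cubical homotopy equivalences) and directed homotopy equivalences respectively. Let $d(\mathrm{Cat}^G)$ be the quotient of the category $\mathrm{Cat}^G$ of $G$-categories by $\sim$, and let $d(\hat\square^G)$ be the localization of the category $\hat\square^G$ of $G$-cubical sets at the class of those $\psi$ for which $|\psi|$ is a directed homotopy equivalence of $G$-streams. Theorem. For every small category $G$: (1) The quotient functor $\mathrm{Cat}^G\to d(\mathrm{Cat}^G)$ is a localization of $\mathrm{Cat}^G$ at the $\mathrm T_1\mathfrak d_*$-equivalences. (2) There is a fully faithful functor $d(\mathrm{Cat}^G)\to d(\hat\square^G)$ such that the square formed with $\mathrm{ner}:\mathrm{Cat}^G\to\hat\square^G$, the quotient functor and the localization functor $\hat\square^G\to d(\hat\square^G)$ commutes up to natural isomorphism. The same holds with $d(\hat\square^G)$ replaced by the localization of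 $\hat\square^G$ at the $\mathfrak d_*$-equivalences. (3) A $G$-functor $F:A\to B$ is a $\mathrm T_1\mathfrak d_*$-equivalence if and only if $|\mathrm{ner}\,F|:|\mathrm{ner}\,A|\to|\mathrm{ner}\,B|$ is a directed homotopy equivalence of $G$-streams. In particular (for $G$ the one-morphism category), a functor of small categories is an equivalence up to zig-zags of natural transformations if and only if it induces a directed homotopy equivalence of directed classifying spaces. -/

import Mathlib

open CategoryTheory Opposite TopologicalSpace
open scoped unitInterval

universe u v w

namespace DirHtpy

/-! ### Homotopy with respect to an interval -/

section Abstract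

variable {C : Type*} [Category C]

/-- A functorial cylinder `X ↦ X ⊗ 𝔦[1]`, with its two end inclusions. -/
structure Cylinder (C : Type*) [Category C] where
  cyl : C ⥤ C
  ι₀ : 𝟭 C ⟶ cyl
  ι₁ : 𝟭 C ⟶ cyl

/-- A functorial path object `X ↦ X ^ 𝔦[1]`, with its two end evaluations. -/
structure PathObject (C : Type*) [Category C] where
  path : C ⥤ C
  π₀ : path ⟶ 𝟭 C
  π₁ : path ⟶ 𝟭 C

/-- `f ⇝ g`: there is a left homotopy from `f` to `g`. -/
def Cylinder.Homotopic (K : Cylinder C) : HomRel C := fun X Y f g =>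
  ∃ h : K.cyl.obj X ⟶ Y, K.ι₀.app X ≫ h = f ∧ K.ι₁.app X ≫ h = g

/-- `f ⇝ g`: there is a right homotopy from `f` to `g`. -/
def PathObject.Homotopic (P : PathObject C) : HomRel C := fun X Y f g =>
  ∃ h : X ⟶ P.path.obj Y, h ≫ P.π₀.app Y = f ∧ h ≫ P.π₁.app Y = g

/-- The cylinder on `G`-shaped diagrams, computed objectwise. -/
def Cylinder.diagram (K : Cylinder C) (G : Type*) [Category G] : Cylinder (G ⥤ C) where
  cyl := (Functor.whiskeringRight G C C).obj K.cyl
  ι₀ := { app := fun X => Functor.whiskerLeft X K.ι₀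
          naturality := fun _ _ f => by
            ext g
            exact K.ι₀.naturality (f.app g) }
  ι₁ := { app := fun X => Functor.whiskerLeft X K.ι₁
          naturality := fun _ _ f => by
            ext g
            exact K.ι₁.naturality (f.app g) }

/-- The path object on `G`-shaped diagrams, computed objectwise. -/
def PathObject.diagram (P : PathObject C) (G : Type*) [Category G] : PathObject (G ⥤ C) where
  path := (Functor.whiskeringRight G C C).obj P.path
  π₀ := { app := fun X => Functor.whiskerLeft X P.π₀
          naturality := fun _ _ f => by
            ext g
            exact P.π₀.naturality (f.app g) }
  π₁ := { app := fun X => Functor.whiskerLeft X P.π₁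
          naturality := fun _ _ f => by
            ext g
            exact P.π₁.naturality (f.app g) }

/-- Two parallel morphisms are related if a finite zig-zag of homotopies joins them. -/
def ZigZag (r : HomRel C) : HomRel C := fun X Y => Relation.EqvGen (@r X Y)

/-- The morphisms that are invertible up to zig-zags of homotopies. -/
def zigZagEquivalences (r : HomRel C) : MorphismProperty C := fun X Y f =>
  ∃ g : Y ⟶ X, ZigZag r (𝟙 X) (f ≫ g) ∧ ZigZag r (𝟙 Y) (g ≫ f)

end Abstract

/-! ### The cube category and cubical sets -/

/-- The objects `[1]ⁿ` of the cube category `□`. -/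
structure Box : Type where
  dim : ℕ

namespace Box

/-- A morphism `[1]ᵐ ⟶ [1]ⁿ` of the symmetric monoidal subcategory of `Cat` generated by the two
maps `δ± : [0] ⟶ [1]` and `σ : [1] ⟶ [0]`, i.e. a composite of cofaces, codegeneracies and
coordinate permutations.  Each of the `n` coordinates of the output is an input coordinate or a
constant (`false` for `0`, `true` for `1`), and no input coordinate is used twice. -/
@[ext]
structure Hom (m n : Box) : Type where
  coord : Fin n.dim → Fin m.dim ⊕ Bool
  inj : ∀ ⦃j j' : Fin n.dim⦄ ⦃i : Fin m.dim⦄,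
    coord j = Sum.inl i → coord j' = Sum.inl i → j = j'

instance : Category Box where
  Hom := Hom
  id n := ⟨Sum.inl, fun _ _ _ h h' => Sum.inl_injective (h.trans h'.symm)⟩
  comp f g :=
    { coord := fun j => Sum.elim f.coord Sum.inr (g.coord j)
      inj := by
        intro j j' i h h'
        rcases hg : g.coord j with k | b <;> rcases hg' : g.coord j' with k' | b' <;>
          simp only [hg, hg', Sum.elim_inl, Sum.elim_inr, reduceCtorEq] at h h'
        have := f.inj h h'
        subst this
        exact g.inj hg hg' }
  id_comp f := by
    apply Hom.ext; funext j
    change Sum.elim Sum.inl Sum.inr (f.coord j) = f.coord j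
    cases f.coord j <;> rfl
  comp_id f := rfl
  assoc f g h := by
    apply Hom.ext; funext j
    change Sum.elim (fun k => Sum.elim f.coord Sum.inr (g.coord k)) Sum.inr (h.coord j) =
      Sum.elim f.coord Sum.inr (Sum.elim g.coord Sum.inr (h.coord j))
    cases h.coord j <;> rfl

/-- The function `Pᵐ → Pⁿ` given by a morphism of `□`, for a bounded order `P`. It is used
for `P = {0 < 1}` and for the unit interval. -/
def eval {m n : Box} (f : m ⟶ n) (P : Type*) [LE P] [BoundedOrder P] (x : Fin m.dim → P) :
    Fin n.dim → P :=
  fun j => Sum.elim x (fun b => if b then ⊤ else ⊥) (f.coord j)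

section eval

variable {l m n : Box} (P : Type*) [Preorder P] [BoundedOrder P]

lemma eval_id (x : Fin m.dim → P) : eval (𝟙 m) P x = x := rfl

lemma eval_comp (f : l ⟶ m) (g : m ⟶ n) (x : Fin l.dim → P) :
    eval (f ≫ g) P x = eval g P (eval f P x) := by
  funext j
  change Sum.elim x _ (Sum.elim f.coord Sum.inr (g.coord j)) =
    Sum.elim (eval f P x) _ (g.coord j)
  cases g.coord j <;> rfl

lemma eval_mono (f : m ⟶ n) : Monotone (eval f P) := by
  intro x y h j
  change Sum.elim x _ (f.coord j) ≤ Sum.elim y _ (f.coord j)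
  cases f.coord j with
  | inl i => exact h i
  | inr b => exact le_rfl

end eval

/-- The poset `[1]ⁿ` with the product order, regarded as a category. -/
def Vert (n : Box) : Type := Fin n.dim → Bool

instance (n : Box) : PartialOrder (Vert n) := inferInstanceAs (PartialOrder (Fin n.dim → Bool))

/-- The inclusion `□ ⟶ Cat` on morphisms. -/
def evalFunctor {m n : Box} (f : m ⟶ n) : Vert m ⥤ Vert n :=
  Monotone.functor (X := Vert m) (Y := Vert n) (f := eval f Bool) (eval_mono Bool f)

lemma evalFunctor_comp {l m n : Box} (f : l ⟶ m) (g : m ⟶ n) :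
    evalFunctor (f ≫ g) = evalFunctor f ⋙ evalFunctor g :=
  CategoryTheory.Functor.ext (fun x => eval_comp Bool f g x) (fun _ _ _ => Subsingleton.elim _ _)

/-- The endofunctor `[1] ⊗ -` of `□`. -/
def shift : Box ⥤ Box where
  obj n := ⟨n.dim + 1⟩
  map {m n} f :=
    { coord := Fin.cases (Sum.inl 0) fun j => Sum.map Fin.succ id (f.coord j)
      inj := by
        intro j j' i h h'
        induction j using Fin.cases with
        | zero =>
          induction j' using Fin.cases with
          | zero => rfl
          | succ j' =>
            rcases hf : f.coord j' with k | b <;> simp [hf] at h h'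
            exact absurd (h.trans h'.symm) (Fin.succ_ne_zero k).symm
        | succ j =>
          induction j' using Fin.cases with
          | zero =>
            rcases hf : f.coord j with k | b <;> simp [hf] at h h'
            exact absurd (h.trans h'.symm) (Fin.succ_ne_zero k)
          | succ j' =>
            rcases hf : f.coord j with k | b <;> rcases hf' : f.coord j' with k' | b' <;>
              simp [hf, hf'] at h h'
            have := Fin.succ_injective _ (h.trans h'.symm)
            subst this
            exact congrArg Fin.succ (f.inj hf hf') }
  map_id n := by
    apply Hom.ext; funext j
    induction j using Fin.cases <;> rfl
  map_comp f g := by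
    apply Hom.ext; funext j
    induction j using Fin.cases with
    | zero => rfl
    | succ j =>
      change Sum.map Fin.succ id (Sum.elim f.coord Sum.inr (g.coord j)) =
        Sum.elim _ Sum.inr (Sum.map Fin.succ id (g.coord j))
      cases g.coord j <;> rfl

/-- The coface `δ± ⊗ [1]ⁿ : [1]ⁿ ⟶ [1] ⊗ [1]ⁿ`, with sign given by `ε`. -/
def coface (ε : Bool) : 𝟭 Box ⟶ shift where
  app n :=
    { coord := Fin.cases (Sum.inr ε) Sum.inl
      inj := by
        intro j j' i h h'
        induction j using Fin.cases with
        | zero => simp at h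
        | succ j =>
          induction j' using Fin.cases with
          | zero => simp at h'
          | succ j' =>
            exact congrArg Fin.succ (Sum.inl_injective (h.trans h'.symm)) }
  naturality m n f := by
    apply Hom.ext; funext j
    induction j using Fin.cases with
    | zero => rfl
    | succ j =>
      change Sum.elim _ Sum.inr (Sum.inl j) = Sum.elim _ Sum.inr (Sum.map Fin.succ id (f.coord j))
      change f.coord j = _
      cases f.coord j <;> rfl

end Box

/-- Cubical sets: presheaves on `□`. -/
abbrev CubicalSet : Type (u + 1) := Boxᵒᵖ ⥤ Type u

/-- The path object `B ↦ B ^ □[1]` of cubical sets, whose `n`-cubes are the cubical functions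
`□[1] ⊗ □[1]ⁿ ⟶ B`, that is, the `(n+1)`-cubes of `B`. -/
def cubicalPath : PathObject CubicalSet.{u} where
  path := (Functor.whiskeringLeft _ _ _).obj Box.shift.op
  π₀ := { app := fun B => { app := fun n => B.map ((Box.coface false).app n.unop).op
                            naturality := fun m n f => by
                              have := (Box.coface false).naturality f.unop
                              dsimp at this ⊢
                              rw [← B.map_comp, ← B.map_comp, ← op_comp, ← this]; rfl } }
  π₁ := { app := fun B => { app := fun n => B.map ((Box.coface true).app n.unop).op
                            naturality := fun m n f => by
                              have := (Box.coface true).naturality f.unop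
                              dsimp at this ⊢
                              rw [← B.map_comp, ← B.map_comp, ← op_comp, ← this]; rfl } }

/-- The cubical nerve: the `n`-cubes of `ner A` are the functors `[1]ⁿ ⥤ A`. -/
def ner : Cat.{u, u} ⥤ CubicalSet.{u} where
  obj A :=
    { obj := fun n => Box.Vert n.unop ⥤ A
      map := fun f => TypeCat.ofHom fun F => Box.evalFunctor f.unop ⋙ F
      map_id := fun _ => rfl
      map_comp := fun f g => by
        ext F
        change Box.evalFunctor (g.unop ≫ f.unop) ⋙ F = _
        rw [Box.evalFunctor_comp]; rfl }
  map Φ := { app := fun _ => TypeCat.ofHom fun F => F ⋙ Φ.toFunctor }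

/-- The cylinder `A ↦ A × [1]` of small categories. -/
def catCylinder : Cylinder Cat.{u, u} where
  cyl :=
    { obj := fun A => Cat.of (A × Bool)
      map := fun F => (F.toFunctor.prod (𝟭 Bool)).toCatHom }
  ι₀ := { app := fun A => (Prod.sectL A false).toCatHom }
  ι₁ := { app := fun A => (Prod.sectL A true).toCatHom }


/-! ### Streams -/

/-- A circulation on a space assigns to each open set `U` a preorder `≤_U` on `U`, such that the
preorder of a union is the smallest one containing the preorders of the members.
`rel U x y` stands for `x ≤_U y`. -/
@[ext]
structure Circulation (X : Type*) [TopologicalSpace X] where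
  rel : Opens X → X → X → Prop
  left_mem : ∀ {U x y}, rel U x y → x ∈ U
  right_mem : ∀ {U x y}, rel U x y → y ∈ U
  refl : ∀ {U x}, x ∈ U → rel U x x
  trans : ∀ {U x y z}, rel U x y → rel U y z → rel U x z
  rel_sSup : ∀ (𝒪 : Set (Opens X)) (x y : X), rel (sSup 𝒪) x y ↔
    x ∈ sSup 𝒪 ∧ Relation.ReflTransGen (fun a b => ∃ U ∈ 𝒪, rel U a b) x y

namespace Circulation

variable {X Y : Type*} [TopologicalSpace X] [TopologicalSpace Y]

lemma mono (c : Circulation X) {U V : Opens X} (h : U ≤ V) {x y : X} (hxy : c.rel U x y) :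
    c.rel V x y := by
  have e : sSup {U, V} = V := by rw [sSup_pair, sup_eq_right.2 h]
  rw [← e, c.rel_sSup]
  refine ⟨by rw [e]; exact h (c.left_mem hxy), .single ⟨U, by simp, hxy⟩⟩

/-- Chains of pairs related by a local relation, inside `U`. -/
def Chain (s : Opens X → X → X → Prop) (U : Opens X) (x y : X) : Prop :=
  x ∈ U ∧ Relation.ReflTransGen (s U) x y

lemma Chain.trans {s : Opens X → X → X → Prop} {U : Opens X} {x y z : X}
    (h : Chain s U x y) (h' : Chain s U y z) : Chain s U x z :=
  ⟨h.1, h.2.trans h'.2⟩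

/-- The circulation that sends `U` to the preorder on `U` generated by a local relation. -/
def generate (s : Opens X → X → X → Prop)
    (hr : ∀ {U x y}, s U x y → y ∈ U)
    (hm : ∀ {U V x y}, U ≤ V → s U x y → s V x y)
    (hs : ∀ (𝒪 : Set (Opens X)) (x y : X), s (sSup 𝒪) x y →
      Relation.ReflTransGen (fun a b => ∃ U ∈ 𝒪, Chain s U a b) x y) : Circulation X where
  rel := Chain s
  left_mem h := h.1
  right_mem h := by
    rcases Relation.ReflTransGen.cases_tail h.2 with e | ⟨_, _, h'⟩
    · exact e ▸ h.1
    · exact hr h'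
  refl h := ⟨h, .refl⟩
  trans := Chain.trans
  rel_sSup 𝒪 x y := by
    constructor
    · rintro ⟨hx, h⟩
      refine ⟨hx, ?_⟩
      induction h with
      | refl => exact .refl
      | tail _ h ih => exact ih.trans (hs 𝒪 _ _ h)
    · rintro ⟨hx, h⟩
      refine ⟨hx, ?_⟩
      induction h with
      | refl => exact .refl
      | tail _ h ih =>
        obtain ⟨U, hU, h⟩ := h
        exact ih.trans (h.2.lift id fun a b hab => hm (le_sSup hU) hab)

end Circulation

/-- A stream: a topological space with a circulation. Directed realizations of cubical sets and
their products with the directed interval, the only streams used below, are Hausdorff k-streams, so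
it makes no difference whether their stream maps are taken here or in the full subcategory of
weak Hausdorff k-streams. -/
structure Strm : Type (u + 1) where
  carrier : Type u
  [top : TopologicalSpace carrier]
  circ : Circulation carrier

namespace Strm

instance : CoeSort Strm.{u} (Type u) := ⟨Strm.carrier⟩

instance (X : Strm.{u}) : TopologicalSpace X := X.top

/-- A stream map: a continuous function `f` such that `x ≤_{f⁻¹ V} y` implies `f x ≤_V f y`. -/
@[ext]
structure Hom (X Y : Strm.{u}) where
  toFun : C(X, Y)
  map_rel : ∀ (V : Opens Y) (x y : X),
    X.circ.rel (V.comap toFun) x y → Y.circ.rel V (toFun x) (toFun y)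

instance : Category Strm.{u} where
  Hom := Hom
  id X := ⟨ContinuousMap.id X, fun _ _ _ h => h⟩
  comp f g := ⟨g.toFun.comp f.toFun, fun V _ _ h => g.map_rel V _ _ (f.map_rel _ _ _ h)⟩

end Strm

/-! #### Directed cubes -/

/-- The circulation of a pospace `P` in which order intervals are small and contain monotone
paths: `x ≤_U y` is generated by the pairs `x ≤ y` whose order interval lies in `U`. In
particular `≤_P` is the given order; no other circulation on `P` has that property. -/
def orderCirc (P : Type*) [PseudoMetricSpace P] [Preorder P]
    (hconv : ∀ x y z : P, x ≤ z → z ≤ y → dist z x ≤ dist y x)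
    (hpath : ∀ x y : P, x ≤ y → ∃ γ : C(I, P), Monotone γ ∧ γ 0 = x ∧ γ 1 = y) :
    Circulation P :=
  Circulation.generate (fun U x y => x ≤ y ∧ Set.Icc x y ⊆ U)
    (fun h => h.2 ⟨h.1, le_rfl⟩)
    (fun hUV h => ⟨h.1, h.2.trans hUV⟩)
    (by
      rintro 𝒪 x y ⟨hxy, hU⟩
      obtain ⟨γ, hγ, h0, h1⟩ := hpath x y hxy
      let ι := {q : P × ℝ // 0 < q.2 ∧ ∃ U ∈ 𝒪, Metric.ball q.1 (3 * q.2) ⊆ (U : Set P)}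
      obtain ⟨t, t0, tm, ⟨N, hN⟩, hc⟩ := exists_monotone_Icc_subset_open_cover_unitInterval
        (c := fun q : ι => γ ⁻¹' Metric.ball q.1.1 q.1.2)
        (fun q => Metric.isOpen_ball.preimage γ.continuous) (by
          intro s _
          have hs : γ s ∈ (sSup 𝒪 : Opens P) :=
            hU ⟨h0 ▸ hγ bot_le, h1 ▸ hγ le_top⟩
          obtain ⟨U, hU, hs⟩ := Opens.mem_sSup.1 hs
          obtain ⟨ε, hε, hb⟩ := Metric.isOpen_iff.1 U.isOpen _ hs
          refine Set.mem_iUnion.2 ⟨⟨(γ s, ε / 3), by positivity, U, hU, ?_⟩, ?_⟩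
          · rwa [mul_div_cancel₀ _ (by norm_num : (3 : ℝ) ≠ 0)]
          · simp only [Set.mem_preimage]
            exact Metric.mem_ball_self (by positivity))
      have key : ∀ n, Relation.ReflTransGen (fun a b => ∃ U ∈ 𝒪, Circulation.Chain
          (fun (U : Opens P) x y => x ≤ y ∧ Set.Icc x y ⊆ U) U a b) x (γ (t n)) := by
        intro n
        induction n with
        | zero => rw [t0, h0]
        | succ n ih =>
          refine ih.tail ?_
          obtain ⟨⟨⟨p, ε⟩, hε, U, hU, hb⟩, hq⟩ := hc n
          have ha : dist (γ (t n)) p < ε := hq ⟨le_rfl, tm n.le_succ⟩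
          have hb' : dist (γ (t (n + 1))) p < ε := hq ⟨tm n.le_succ, le_rfl⟩
          have hle : γ (t n) ≤ γ (t (n + 1)) := hγ (tm n.le_succ)
          have hsub : Set.Icc (γ (t n)) (γ (t (n + 1))) ⊆ (U : Set P) := by
            rintro z ⟨hz, hz'⟩
            apply hb
            have h1 := hconv _ _ _ hz hz'
            have h2 := dist_triangle_right (γ (t (n + 1))) (γ (t n)) p
            have h3 := dist_triangle z (γ (t n)) p
            rw [Metric.mem_ball]
            dsimp only at hε ⊢
            linarith
          exact ⟨U, hU, hsub ⟨le_rfl, hle⟩, .single ⟨hle, hsub⟩⟩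
      have := key N
      rwa [hN N le_rfl, h1] at this)

lemma interval_path (x y : I) (h : x ≤ y) :
    ∃ γ : C(I, I), Monotone γ ∧ γ 0 = x ∧ γ 1 = y := by
  refine ⟨⟨fun s => max x (min y s), by fun_prop⟩, ?_, ?_, ?_⟩
  · intro s t hst
    exact max_le_max le_rfl (min_le_min le_rfl hst)
  · change max x (min y 0) = x
    rw [min_eq_right (unitInterval.nonneg' : (0 : I) ≤ y)]
    exact max_eq_left unitInterval.nonneg'
  · change max x (min y 1) = y
    rw [min_eq_left (unitInterval.le_one' : y ≤ 1)]
    exact max_eq_right h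

lemma interval_dist (x y z : I) (h : x ≤ z) (h' : z ≤ y) : dist z x ≤ dist y x := by
  rw [Subtype.dist_eq, Subtype.dist_eq, Real.dist_eq, Real.dist_eq]
  have h1 : (x : ℝ) ≤ z := h
  have h2 : (z : ℝ) ≤ y := h'
  rw [abs_of_nonneg (by linarith), abs_of_nonneg (by linarith)]
  linarith

/-- The directed unit interval. -/
def intervalCirc : Circulation I := orderCirc I interval_dist interval_path

/-- The directed cube `Iⁿ`, with the product order. -/
def cubeCirc (n : ℕ) : Circulation (Fin n → I) :=
  orderCirc (Fin n → I)
    (fun x y z h h' => (dist_pi_le_iff dist_nonneg).2 fun i =>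
      (interval_dist _ _ _ (h i) (h' i)).trans (dist_le_pi_dist y x i))
    (fun x y h => by
      choose γ hγ h0 h1 using fun i => interval_path (x i) (y i) (h i)
      exact ⟨⟨fun s i => γ i s, by fun_prop⟩, fun s t hst i => hγ i hst, funext h0, funext h1⟩)

/-! #### Products with the directed interval -/

section Prod

variable {X Y : Type*} [TopologicalSpace X] [TopologicalSpace Y]

/-- The basic relation of a product circulation on `W`: related inside an open box in `W`. -/
def boxRel (c : Circulation X) (d : Circulation Y) (W : Opens (X × Y)) (p q : X × Y) : Prop :=
  ∃ (U : Opens X) (V : Opens Y), (U : Set X) ×ˢ (V : Set Y) ⊆ W ∧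
    c.rel U p.1 q.1 ∧ d.rel V p.2 q.2

lemma boxRel_slice_left (c : Circulation X) (d : Circulation Y) (𝒪 : Set (Opens (X × Y)))
    {x x' : X} {y : Y} {U : Opens X} (hU : ∀ a ∈ U, (a, y) ∈ (sSup 𝒪 : Opens (X × Y)))
    (h : c.rel U x x') :
    Relation.ReflTransGen (fun p q => ∃ W ∈ 𝒪, boxRel c d W p q) (x, y) (x', y) := by
  let 𝒰 : Set (Opens X) := {A | ∃ W ∈ 𝒪, ∃ V : Opens Y, y ∈ V ∧ (A : Set X) ×ˢ (V : Set Y) ⊆ W}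
  have hle : U ≤ sSup 𝒰 := by
    intro a ha
    obtain ⟨W, hW, haW⟩ := Opens.mem_sSup.1 (hU a ha)
    obtain ⟨A, V, hA, hV, ha', hy, hs⟩ := isOpen_prod_iff.1 W.isOpen a y haW
    exact Opens.mem_sSup.2 ⟨⟨A, hA⟩, ⟨W, hW, ⟨V, hV⟩, hy, hs⟩, ha'⟩
  have := ((c.rel_sSup 𝒰 x x').1 (c.mono hle h)).2
  refine this.lift (fun a => (a, y)) ?_
  rintro a b ⟨A, ⟨W, hW, V, hy, hs⟩, hab⟩
  exact ⟨W, hW, A, V, hs, hab, d.refl hy⟩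

lemma boxRel_slice_right (c : Circulation X) (d : Circulation Y) (𝒪 : Set (Opens (X × Y)))
    {x : X} {y y' : Y} {V : Opens Y} (hV : ∀ b ∈ V, (x, b) ∈ (sSup 𝒪 : Opens (X × Y)))
    (h : d.rel V y y') :
    Relation.ReflTransGen (fun p q => ∃ W ∈ 𝒪, boxRel c d W p q) (x, y) (x, y') := by
  let 𝒱 : Set (Opens Y) := {B | ∃ W ∈ 𝒪, ∃ U : Opens X, x ∈ U ∧ (U : Set X) ×ˢ (B : Set Y) ⊆ W}
  have hle : V ≤ sSup 𝒱 := by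
    intro b hb
    obtain ⟨W, hW, hbW⟩ := Opens.mem_sSup.1 (hV b hb)
    obtain ⟨U, B, hU, hB, hx, hb', hs⟩ := isOpen_prod_iff.1 W.isOpen x b hbW
    exact Opens.mem_sSup.2 ⟨⟨B, hB⟩, ⟨W, hW, ⟨U, hU⟩, hx, hs⟩, hb'⟩
  have := ((d.rel_sSup 𝒱 y y').1 (d.mono hle h)).2
  refine this.lift (fun b => (x, b)) ?_
  rintro a b ⟨B, ⟨W, hW, U, hx, hs⟩, hab⟩
  exact ⟨W, hW, U, B, hs, c.refl hx, hab⟩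

lemma boxRel_left_mem {c : Circulation X} {d : Circulation Y} {W : Opens (X × Y)} {p q : X × Y}
    (h : boxRel c d W p q) : p ∈ W := by
  obtain ⟨U, V, hs, h1, h2⟩ := h
  exact hs ⟨c.left_mem h1, d.left_mem h2⟩

lemma boxRel_right_mem {c : Circulation X} {d : Circulation Y} {W : Opens (X × Y)} {p q : X × Y}
    (h : boxRel c d W p q) : q ∈ W := by
  obtain ⟨U, V, hs, h1, h2⟩ := h
  exact hs ⟨c.right_mem h1, d.right_mem h2⟩

/-- The product circulation: the largest circulation on `X × Y` for which both projections are
stream maps. -/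
def prodCirc (c : Circulation X) (d : Circulation Y) : Circulation (X × Y) :=
  Circulation.generate (boxRel c d) boxRel_right_mem
    (fun hW => by
      rintro ⟨U, V, hs, h1, h2⟩
      exact ⟨U, V, hs.trans hW, h1, h2⟩)
    (by
      rintro 𝒪 ⟨x, y⟩ ⟨x', y'⟩ ⟨U, V, hs, h1, h2⟩
      have e1 := boxRel_slice_left c d 𝒪 (y := y)
        (fun a ha => hs (Set.mk_mem_prod ha (d.left_mem h2))) h1
      have e2 := boxRel_slice_right c d 𝒪 (x := x')
        (fun b hb => hs (Set.mk_mem_prod (c.right_mem h1) hb)) h2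
      refine (e1.trans e2).lift id ?_
      rintro p q ⟨W, hW, h⟩
      exact ⟨W, hW, boxRel_left_mem h, .single h⟩)

lemma prodCirc_slice_left (c : Circulation X) (d : Circulation Y) {W : Opens (X × Y)}
    {x x' : X} {y : Y} {U : Opens X} (hU : ∀ a ∈ U, (a, y) ∈ W) (h : c.rel U x x') :
    (prodCirc c d).rel W (x, y) (x', y) :=
  ⟨hU _ (c.left_mem h),
    (boxRel_slice_left c d {W} (by simpa using hU) h).lift id (by
      rintro p q ⟨_, rfl, h⟩
      exact h)⟩

lemma prodCirc_slice_right (c : Circulation X) (d : Circulation Y) {W : Opens (X × Y)}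
    {x : X} {y y' : Y} {V : Opens Y} (hV : ∀ b ∈ V, (x, b) ∈ W) (h : d.rel V y y') :
    (prodCirc c d).rel W (x, y) (x, y') :=
  ⟨hV _ (d.left_mem h),
    (boxRel_slice_right c d {W} (by simpa using hV) h).lift id (by
      rintro p q ⟨_, rfl, h⟩
      exact h)⟩

end Prod

namespace Strm

/-- The product of a stream with the directed interval. -/
def cylObj (X : Strm.{u}) : Strm.{u} where
  carrier := X × I
  circ := prodCirc X.circ intervalCirc

/-- The end inclusion `x ↦ (x, t)`. -/
def cylIncl (X : Strm.{u}) (t : I) : X ⟶ X.cylObj where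
  toFun := ⟨fun x => (x, t), by fun_prop⟩
  map_rel _ _ _ h := prodCirc_slice_left _ _ (fun _ ha => ha) h

/-- The stream map `f × id`. -/
def cylMap {X Y : Strm.{u}} (f : X ⟶ Y) : X.cylObj ⟶ Y.cylObj where
  toFun := ⟨fun p => (f.toFun p.1, p.2), by fun_prop⟩
  map_rel W p q h := by
    obtain ⟨hp, h⟩ := h
    refine ⟨hp, ?_⟩
    induction h with
    | refl => exact .refl
    | @tail a b _ hab ih =>
      refine ih.trans ?_
      obtain ⟨U, V, hs, h1, h2⟩ := hab
      let Wy : Opens Y := W.comap ⟨fun y => (y, a.2), by fun_prop⟩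
      have e : X.circ.rel (Wy.comap f.toFun) a.1 b.1 :=
        X.circ.mono (fun x hx => hs (Set.mk_mem_prod hx (intervalCirc.left_mem h2))) h1
      have e1 := prodCirc_slice_left Y.circ intervalCirc (W := W) (y := a.2) (U := Wy)
        (fun _ hy => hy) (f.map_rel Wy _ _ e)
      have e2 := prodCirc_slice_right Y.circ intervalCirc (W := W) (x := f.toFun b.1) (V := V)
        (fun t ht => hs (Set.mk_mem_prod (X.circ.right_mem h1) ht)) h2
      exact (e1.trans e2).2

/-- The cylinder `X ↦ X × I` of streams. -/
def cylinder : Cylinder Strm.{u} where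
  cyl :=
    { obj := cylObj
      map := cylMap
      map_id := fun _ => rfl
      map_comp := fun _ _ => rfl }
  ι₀ := { app := fun X => X.cylIncl 0 }
  ι₁ := { app := fun X => X.cylIncl 1 }

end Strm

/-! ### Directed realization -/

/-- The circulation on `X` induced by a family of continuous functions from streams: the smallest
one for which all of them are stream maps. -/
def finalCirc {ι : Type*} {X : Type*} [TopologicalSpace X] {A : ι → Type*}
    [∀ i, TopologicalSpace (A i)] (c : ∀ i, Circulation (A i)) (f : ∀ i, C(A i, X)) :
    Circulation X :=
  Circulation.generate
    (fun U x y => ∃ i a b, (c i).rel (U.comap (f i)) a b ∧ f i a = x ∧ f i b = y)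
    (by rintro U _ _ ⟨i, a, b, h, rfl, rfl⟩; exact (c i).right_mem h)
    (by
      rintro U V _ _ hUV ⟨i, a, b, h, rfl, rfl⟩
      exact ⟨i, a, b, (c i).mono (fun z hz => hUV hz) h, rfl, rfl⟩)
    (by
      rintro 𝒪 _ _ ⟨i, a, b, h, rfl, rfl⟩
      have e : (sSup 𝒪).comap (f i) = sSup ((fun U : Opens X => U.comap (f i)) '' 𝒪) := by
        ext z; simp
      rw [e, (c i).rel_sSup] at h
      refine h.2.lift (f i) ?_
      rintro p q ⟨_, ⟨U, hU, rfl⟩, hpq⟩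
      exact ⟨U, hU, (c i).left_mem hpq, .single ⟨i, p, q, hpq, rfl, rfl⟩⟩)

namespace CubicalSet

/-- All cubes of a cubical set. -/
abbrev Cell (C : CubicalSet.{u}) : Type u := Σ n : Box, C.obj (op n)

/-- The disjoint union of one topological cube `Iⁿ` for each `n`-cube. -/
abbrev PreRealization (C : CubicalSet.{u}) : Type u := Σ x : C.Cell, (Fin x.1.dim → I)

/-- The gluing `(φ^* c, s) ∼ (c, |φ| s)` for `φ : [1]ᵐ ⟶ [1]ⁿ`, an `n`-cube `c` and `s ∈ Iᵐ`. -/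
inductive Glue (C : CubicalSet.{u}) : C.PreRealization → C.PreRealization → Prop
  | mk {m n : Box} (φ : m ⟶ n) (c : C.obj (op n)) (s : Fin m.dim → I) :
    Glue C ⟨⟨m, C.map φ.op c⟩, s⟩ ⟨⟨n, c⟩, Box.eval φ I s⟩

/-- The points of the topological realization, with the quotient topology. -/
abbrev Realization (C : CubicalSet.{u}) : Type u := Quot C.Glue

/-- The characteristic map of a cube. -/
def charMap (C : CubicalSet.{u}) (x : C.Cell) : C(Fin x.1.dim → I, C.Realization) :=
  ⟨fun s => Quot.mk _ ⟨x, s⟩, continuous_quot_mk.comp continuous_sigmaMk⟩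

end CubicalSet

/-- The directed realization on objects: the topological realization, with the circulation
induced by the characteristic maps of all cubes. -/
def directedRealizationObj (C : CubicalSet.{u}) : Strm.{u} where
  carrier := C.Realization
  circ := finalCirc (fun x : C.Cell => cubeCirc x.1.dim) C.charMap

/-- The directed realization on morphisms: `[c, s] ↦ [ψ c, s]`. -/
def directedRealizationMap {B C : CubicalSet.{u}} (ψ : B ⟶ C) :
    directedRealizationObj B ⟶ directedRealizationObj C where
  toFun := ⟨Quot.map (fun p => ⟨⟨p.1.1, ψ.app _ p.1.2⟩, p.2⟩) (by
      rintro _ _ ⟨φ, c, s⟩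
      have := NatTrans.naturality_apply ψ φ.op c
      dsimp only
      rw [this]
      exact .mk φ _ s),
    continuous_quot_lift _ (continuous_sigma fun x =>
      (C.charMap ⟨x.1, ψ.app _ x.2⟩).continuous)⟩
  map_rel V x y h := by
    refine ⟨h.1, h.2.lift _ ?_⟩
    rintro _ _ ⟨x, a, b, h, rfl, rfl⟩
    exact ⟨⟨x.1, ψ.app _ x.2⟩, a, b, h, rfl, rfl⟩

/-- The directed realization functor. -/
def directedRealization : CubicalSet.{u} ⥤ Strm.{u} where
  obj := directedRealizationObj
  map := directedRealizationMap
  map_id C := by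
    apply Strm.Hom.ext
    ext ⟨p⟩
    rfl
  map_comp f g := by
    apply Strm.Hom.ext
    ext ⟨p⟩
    rfl

/-! ### Equivariant homotopy categories -/

section Equivariant

variable (G : Type u) [SmallCategory G]

/-- The homotopies `A × [1] ⟶ B` of `G`-functors: natural transformations compatible with `G`. -/
def catHomotopic : HomRel (G ⥤ Cat.{u, u}) := (catCylinder.diagram G).Homotopic

/-- The category `d(Cat^G)`: `G`-categories and `G`-functors up to zig-zags of homotopies. -/
abbrev dCat : Type (u + 1) := Quotient (ZigZag (catHomotopic G))

/-- The quotient functor `Cat^G ⥤ d(Cat^G)`. -/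
def dCatQuotient : (G ⥤ Cat.{u, u}) ⥤ dCat G := Quotient.functor _

/-- The equivalences of `G`-categories up to zig-zags of homotopies. -/
def catEquivalences : MorphismProperty (G ⥤ Cat.{u, u}) := zigZagEquivalences (catHomotopic G)

/-- The equivalences of `G`-streams up to zig-zags of directed homotopies. -/
def streamEquivalences : MorphismProperty (G ⥤ Strm.{u}) :=
  zigZagEquivalences (Strm.cylinder.diagram G).Homotopic

/-- The equivalences of `G`-cubical sets up to zig-zags of cubical homotopies. -/
def cubicalEquivalences : MorphismProperty (G ⥤ CubicalSet.{u}) :=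
  zigZagEquivalences (cubicalPath.diagram G).Homotopic

/-- The objectwise cubical nerve. -/
def nerDiagram : (G ⥤ Cat.{u, u}) ⥤ (G ⥤ CubicalSet.{u}) :=
  (Functor.whiskeringRight G _ _).obj ner

/-- The objectwise directed realization. -/
def directedRealizationDiagram : (G ⥤ CubicalSet.{u}) ⥤ (G ⥤ Strm.{u}) :=
  (Functor.whiskeringRight G _ _).obj directedRealization

/-- The `G`-cubical functions whose directed realizations are directed homotopy equivalences.
The category `d(□̂^G)` is the localization at this class. -/
def directedEquivalences : MorphismProperty (G ⥤ CubicalSet.{u}) :=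
  (streamEquivalences G).inverseImage (directedRealizationDiagram G)

end Equivariant

end DirHtpy

namespace DirHtpy

open Filter Topology

/-! ### Homotopy relations and localizations -/

section Abstract

variable {C : Type*} [Category C] {D : Type*} [Category D]

/-! The nerve has a left adjoint `T`, the fundamental category, and is fully faithful, so the counit
of `T ⊣ ner` is invertible. An adjunction with fully faithful right adjoint descends to
localizations as soon as both functors preserve the equivalences, and the right adjoint stays fully
faithful. This gives (2), and (3) follows since `F` is isomorphic to `T (ner F)`. Statement (1)
holds because the projection `A × [1] ⟶ A` is itself an equivalence, so a functor inverting
equivalences identifies the two ends of the cylinder.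

The functors `ner`, `T`, realization and `sing` (singular cubes) preserve homotopies, each by a
natural comparison of cylinders and path objects. The hard point is that `T` sends `ψ` to an
equivalence when only `|ψ|` is known to be a directed homotopy equivalence. Then `sing |ψ|` is a
cubical homotopy equivalence, so `T (sing |ψ|)` is an equivalence, and equivalences are stable under
retracts. Hence it suffices to exhibit `T ψ` as a retract of `T (sing |ψ|)`; by adjunction
(`adjunctRetraction`) this reduces to a natural retraction `sing |ner A| ⟶ ner A` of the unit
(`nerRetraction`, `singUnit_nerRetraction`).

To construct it, a point `[c, x]` of `|ner A|` is rounded to the object `c v`, where `v j = 1` iff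
`x j ≥ 1/2`. This is discontinuous. Given a point `p`, take `η < 1/2` above all its coordinates
below `1/2`; for `q` near `p`, lowering the threshold from `1/2` to `η` yields an arrow from the
rounding of `q` to that of `p`, and this arrow is an identity if `q` is reached from `p` in the
upward direction. So morphisms into a fixed object continue locally along a singular cube, by
precomposition, and are constant upwards. Each value at the top of the cube then extends over the
cube (`extends_all`) in one way only (`Section.eq_of_eq_top`). Continuing identities downwards
between vertices gives a functor on `[1]ⁿ` (`singRetract`); uniqueness makes the construction
functorial and natural.

A point has many representatives, with degenerate coordinates of arbitrary value. So the coordinates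
at `η` cannot be required to be absent, only to be irrelevant to `c`; this is the role of `Indep`.
-/

lemma Cylinder.Homotopic.comp_left (K : Cylinder C) {X Y Z : C} (f : X ⟶ Y) {g g' : Y ⟶ Z}
    (h : K.Homotopic g g') : K.Homotopic (f ≫ g) (f ≫ g') := by
  obtain ⟨h, rfl, rfl⟩ := h
  refine ⟨K.cyl.map f ≫ h, ?_, ?_⟩
  · rw [← Category.assoc, ← K.ι₀.naturality, Category.assoc]; rfl
  · rw [← Category.assoc, ← K.ι₁.naturality, Category.assoc]; rfl

lemma Cylinder.Homotopic.comp_right (K : Cylinder C) {X Y Z : C} {f f' : X ⟶ Y} (g : Y ⟶ Z)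
    (h : K.Homotopic f f') : K.Homotopic (f ≫ g) (f' ≫ g) := by
  obtain ⟨h, rfl, rfl⟩ := h
  exact ⟨h ≫ g, by simp, by simp⟩

lemma ZigZag.map {r : HomRel C} {s : HomRel D} (Φ : C ⥤ D)
    (hΦ : ∀ {X Y : C} (f g : X ⟶ Y), r f g → s (Φ.map f) (Φ.map g)) {X Y : C} {f g : X ⟶ Y}
    (h : ZigZag r f g) : ZigZag s (Φ.map f) (Φ.map g) := by
  induction h with
  | rel f g h => exact .rel _ _ (hΦ f g h)
  | refl f => exact .refl _
  | symm f g _ ih => exact .symm _ _ ih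
  | trans f g k _ _ ih ih' => exact .trans _ _ _ ih ih'

lemma zigZagEquivalences.map {r : HomRel C} {s : HomRel D} (Φ : C ⥤ D)
    (hΦ : ∀ {X Y : C} (f g : X ⟶ Y), r f g → s (Φ.map f) (Φ.map g)) {X Y : C} {f : X ⟶ Y}
    (h : zigZagEquivalences r f) : zigZagEquivalences s (Φ.map f) := by
  obtain ⟨g, h, h'⟩ := h
  exact ⟨Φ.map g, by simpa using h.map Φ hΦ, by simpa using h'.map Φ hΦ⟩

instance Cylinder.congruence_zigZag (K : Cylinder C) : Congruence (ZigZag K.Homotopic) where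
  equivalence := Relation.EqvGen.is_equivalence _
  comp_left f _ _ h := by
    induction h with
    | rel _ _ h => exact .rel _ _ (h.comp_left K f)
    | refl _ => exact .refl _
    | symm _ _ _ ih => exact .symm _ _ ih
    | trans _ _ _ _ _ ih ih' => exact .trans _ _ _ ih ih'
  comp_right g h := by
    induction h with
    | rel _ _ h => exact .rel _ _ (h.comp_right K g)
    | refl _ => exact .refl _
    | symm _ _ _ ih => exact .symm _ _ ih
    | trans _ _ _ _ _ ih ih' => exact .trans _ _ _ ih ih'

/-- The equivalences are the morphisms that become invertible in the quotient category. -/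
lemma zigZagEquivalences_eq_inverseImage (r : HomRel C) [Congruence (ZigZag r)] :
    zigZagEquivalences r =
      (MorphismProperty.isomorphisms _).inverseImage (Quotient.functor (ZigZag r)) := by
  ext X Y f
  simp only [MorphismProperty.inverseImage_iff, MorphismProperty.isomorphisms.iff]
  constructor
  · rintro ⟨g, h, h'⟩
    refine ⟨(Quotient.functor _).map g, ?_, ?_⟩
    · rw [← Functor.map_comp, ← CategoryTheory.Quotient.sound _ h, CategoryTheory.Functor.map_id]
    · rw [← Functor.map_comp, ← CategoryTheory.Quotient.sound _ h', CategoryTheory.Functor.map_id]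
  · rintro ⟨g, h, h'⟩
    obtain ⟨g, rfl⟩ := (Quotient.functor (ZigZag r)).map_surjective g
    refine ⟨g, ?_, ?_⟩
    · rw [← CategoryTheory.Quotient.functor_map_eq_iff (ZigZag r), CategoryTheory.Functor.map_id,
        Functor.map_comp, h]
    · rw [← CategoryTheory.Quotient.functor_map_eq_iff (ZigZag r), CategoryTheory.Functor.map_id,
        Functor.map_comp, h']

/-- A functor that inverts the equivalences identifies homotopic morphisms, if the cylinder has a
projection that is an equivalence. -/
lemma Cylinder.map_eq_of_zigZag (K : Cylinder C) (p : K.cyl ⟶ 𝟭 C)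
    (h₀ : ∀ X, K.ι₀.app X ≫ p.app X = 𝟙 X) (h₁ : ∀ X, K.ι₁.app X ≫ p.app X = 𝟙 X)
    (hp : ∀ X, zigZagEquivalences K.Homotopic (p.app X)) (F : C ⥤ D)
    (hF : (zigZagEquivalences K.Homotopic).IsInvertedBy F) (X Y : C) (f g : X ⟶ Y)
    (h : ZigZag K.Homotopic f g) : F.map f = F.map g := by
  induction h with
  | rel f g h =>
    obtain ⟨h, rfl, rfl⟩ := h
    have := hF _ (hp X)
    -- Both ends are sections of the projection, which `F` inverts.
    have e : F.map (K.ι₀.app X) = F.map (K.ι₁.app X) := by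
      rw [← cancel_mono (F.map (p.app X)), ← F.map_comp, ← F.map_comp]
      exact congrArg _ ((h₀ X).trans (h₁ X).symm)
    simp only [F.map_comp, e]
  | refl _ => rfl
  | symm _ _ _ ih => exact ih.symm
  | trans _ _ _ _ _ ih ih' => exact ih.trans ih'

/-- If the cylinder has a projection that is an equivalence, then dividing out homotopies is a
localization at the equivalences. -/
lemma Cylinder.isLocalization_quotient (K : Cylinder C) (p : K.cyl ⟶ 𝟭 C)
    (h₀ : ∀ X, K.ι₀.app X ≫ p.app X = 𝟙 X) (h₁ : ∀ X, K.ι₁.app X ≫ p.app X = 𝟙 X)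
    (hp : ∀ X, zigZagEquivalences K.Homotopic (p.app X)) :
    (Quotient.functor (ZigZag K.Homotopic)).IsLocalization (zigZagEquivalences K.Homotopic) := by
  have inv : (zigZagEquivalences K.Homotopic).IsInvertedBy
      (Quotient.functor (ZigZag K.Homotopic)) := by
    intro X Y f hf
    rwa [zigZagEquivalences_eq_inverseImage] at hf
  exact Functor.IsLocalization.mk' _ _
    ⟨inv, fun F hF => CategoryTheory.Quotient.lift _ F (K.map_eq_of_zigZag p h₀ h₁ hp F hF),
      fun _ _ => rfl,
      fun _ _ h => CategoryTheory.Quotient.lift_unique' _ _ _ h⟩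
    ⟨inv, fun F hF => CategoryTheory.Quotient.lift _ F (K.map_eq_of_zigZag p h₀ h₁ hp F hF),
      fun _ _ => rfl,
      fun _ _ h => CategoryTheory.Quotient.lift_unique' _ _ _ h⟩

/-- An adjunction with fully faithful right adjoint, both of whose functors preserve the classes
of equivalences, induces a fully faithful functor on localizations. -/
lemma exists_fullyFaithful_of_adjunction {T : C ⥤ D} {N : D ⥤ C} (adj : T ⊣ N) [N.Full]
    [N.Faithful] {C' D' : Type*} [Category C'] [Category D'] (L₁ : C ⥤ C')
    (W₁ : MorphismProperty C) [L₁.IsLocalization W₁] (L₂ : D ⥤ D') (W₂ : MorphismProperty D)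
    [L₂.IsLocalization W₂] (hT : W₁ ≤ W₂.inverseImage T) (hN : W₂ ≤ W₁.inverseImage N) :
    ∃ E : D' ⥤ C', E.Full ∧ E.Faithful ∧ Nonempty (L₂ ⋙ E ≅ N ⋙ L₁) := by
  have iT : W₁.IsInvertedBy (T ⋙ L₂) := fun _ _ f hf => Localization.inverts L₂ W₂ _ (hT f hf)
  have iN : W₂.IsInvertedBy (N ⋙ L₁) := fun _ _ f hf => Localization.inverts L₁ W₁ _ (hN f hf)
  let T' := Localization.lift (T ⋙ L₂) iT L₁
  let N' := Localization.lift (N ⋙ L₁) iN L₂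
  let : CatCommSq T L₁ L₂ T' := ⟨(Localization.fac (T ⋙ L₂) iT L₁).symm⟩
  let : CatCommSq N L₂ L₁ N' := ⟨(Localization.fac (N ⋙ L₁) iN L₂).symm⟩
  let adj' := adj.localization L₁ W₁ L₂ W₂ T' N'
  -- On objects coming from `D` the localized counit is, up to isomorphisms, the image of the counit
  -- of `adj`, which is invertible because `N` is fully faithful. Essential surjectivity of `L₂`
  -- covers the remaining objects.
  have (X : D) : IsIso (adj'.counit.app (L₂.obj X)) := by
    rw [Adjunction.localization_counit_app]
    infer_instance
  have := Localization.essSurj L₂ W₂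
  have (X : D') : IsIso (adj'.counit.app X) := by
    rw [← NatTrans.isIso_app_iff_of_iso adj'.counit (L₂.objObjPreimageIso X)]
    infer_instance
  have : IsIso adj'.counit := NatIso.isIso_of_isIso_app _
  exact ⟨N', adj'.fullyFaithfulROfIsIsoCounit.full, adj'.fullyFaithfulROfIsIsoCounit.faithful,
    ⟨Localization.fac (N ⋙ L₁) iN L₂⟩⟩

/-- A natural transformation `Φ X ⟶ (Φ (X ⊗ 𝔦[1])) ^ 𝔦[1]` makes `Φ` send left homotopies of
diagrams to right homotopies. -/
lemma PathObject.homotopic_map_of_cylinder (K : Cylinder C) (P : PathObject D) (Φ : C ⥤ D)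
    (τ : Φ ⟶ K.cyl ⋙ Φ ⋙ P.path)
    (h₀ : ∀ X, τ.app X ≫ P.π₀.app (Φ.obj (K.cyl.obj X)) = Φ.map (K.ι₀.app X))
    (h₁ : ∀ X, τ.app X ≫ P.π₁.app (Φ.obj (K.cyl.obj X)) = Φ.map (K.ι₁.app X))
    (G : Type*) [Category G] {X Y : G ⥤ C} (f g : X ⟶ Y) (h : (K.diagram G).Homotopic f g) :
    (P.diagram G).Homotopic (((Functor.whiskeringRight G C D).obj Φ).map f)
      (((Functor.whiskeringRight G C D).obj Φ).map g) := by
  have k₀ {X Y : C} (k : K.cyl.obj X ⟶ Y) : (τ.app X ≫ P.path.map (Φ.map k)) ≫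
      P.π₀.app (Φ.obj Y) = Φ.map (K.ι₀.app X ≫ k) := by
    have := P.π₀.naturality (Φ.map k)
    dsimp at this ⊢
    rw [Category.assoc, this, ← Category.assoc, h₀, Φ.map_comp]
  have k₁ {X Y : C} (k : K.cyl.obj X ⟶ Y) : (τ.app X ≫ P.path.map (Φ.map k)) ≫
      P.π₁.app (Φ.obj Y) = Φ.map (K.ι₁.app X ≫ k) := by
    have := P.π₁.naturality (Φ.map k)
    dsimp at this ⊢
    rw [Category.assoc, this, ← Category.assoc, h₁, Φ.map_comp]
  obtain ⟨h, rfl, rfl⟩ := h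
  refine ⟨Functor.whiskerLeft X τ ≫ Functor.whiskerRight h (Φ ⋙ P.path), ?_, ?_⟩
  · ext i
    exact k₀ (h.app i)
  · ext i
    exact k₁ (h.app i)

/-- A natural transformation `Φ (X ^ 𝔦[1]) ⊗ 𝔦[1] ⟶ Φ X` makes `Φ` send right homotopies of
diagrams to left homotopies. -/
lemma Cylinder.homotopic_map_of_pathObject (P : PathObject C) (K : Cylinder D) (Φ : C ⥤ D)
    (τ : P.path ⋙ Φ ⋙ K.cyl ⟶ Φ)
    (h₀ : ∀ X, K.ι₀.app (Φ.obj (P.path.obj X)) ≫ τ.app X = Φ.map (P.π₀.app X))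
    (h₁ : ∀ X, K.ι₁.app (Φ.obj (P.path.obj X)) ≫ τ.app X = Φ.map (P.π₁.app X))
    (G : Type*) [Category G] {X Y : G ⥤ C} (f g : X ⟶ Y) (h : (P.diagram G).Homotopic f g) :
    (K.diagram G).Homotopic (((Functor.whiskeringRight G C D).obj Φ).map f)
      (((Functor.whiskeringRight G C D).obj Φ).map g) := by
  have k₀ {X Y : C} (k : X ⟶ P.path.obj Y) : K.ι₀.app (Φ.obj X) ≫ K.cyl.map (Φ.map k) ≫
      τ.app Y = Φ.map (k ≫ P.π₀.app Y) := by
    have := K.ι₀.naturality (Φ.map k)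
    dsimp at this ⊢
    rw [← Category.assoc, ← this, Category.assoc, h₀, Φ.map_comp]
  have k₁ {X Y : C} (k : X ⟶ P.path.obj Y) : K.ι₁.app (Φ.obj X) ≫ K.cyl.map (Φ.map k) ≫
      τ.app Y = Φ.map (k ≫ P.π₁.app Y) := by
    have := K.ι₁.naturality (Φ.map k)
    dsimp at this ⊢
    rw [← Category.assoc, ← this, Category.assoc, h₁, Φ.map_comp]
  obtain ⟨h, rfl, rfl⟩ := h
  refine ⟨Functor.whiskerRight h (Φ ⋙ K.cyl) ≫ Functor.whiskerLeft Y τ, ?_, ?_⟩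
  · ext i
    exact k₀ (h.app i)
  · ext i
    exact k₁ (h.app i)

/-- The projection of a cylinder is an equivalence of diagrams if the cylinder contracts naturally
onto its bottom. -/
lemma Cylinder.zigZagEquivalences_proj (K : Cylinder C) (p : K.cyl ⟶ 𝟭 C)
    (m : K.cyl ⋙ K.cyl ⟶ K.cyl) (h₀ : ∀ X, K.ι₀.app X ≫ p.app X = 𝟙 X)
    (hm₀ : ∀ X, K.ι₀.app (K.cyl.obj X) ≫ m.app X = p.app X ≫ K.ι₀.app X)
    (hm₁ : ∀ X, K.ι₁.app (K.cyl.obj X) ≫ m.app X = 𝟙 _) (G : Type*) [Category G] (X : G ⥤ C) :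
    zigZagEquivalences (K.diagram G).Homotopic
      (Functor.whiskerLeft X p : (K.diagram G).cyl.obj X ⟶ X) := by
  -- The contraction `m` runs from `p ≫ ι₀` to the identity, hence the reversal. The other composite
  -- is equal to the identity.
  refine ⟨(K.diagram G).ι₀.app X, .symm _ _ (.rel _ _ ⟨Functor.whiskerLeft X m, ?_, ?_⟩), ?_⟩
  · ext i
    exact hm₀ (X.obj i)
  · ext i
    exact hm₁ (X.obj i)
  · have : (K.diagram G).ι₀.app X ≫ (Functor.whiskerLeft X p : (K.diagram G).cyl.obj X ⟶ X) =
        𝟙 X := by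
      ext i
      exact h₀ (X.obj i)
    have key : ZigZag (K.diagram G).Homotopic (𝟙 X) ((K.diagram G).ι₀.app X ≫
        (Functor.whiskerLeft X p : (K.diagram G).cyl.obj X ⟶ X)) := by
      rw [this]
      exact .refl _
    exact key

/-- A left adjoint preserves right homotopies if the right adjoint commutes laxly with path
objects. -/
lemma PathObject.homotopic_map_of_adjunction {T : C ⥤ D} {N : D ⥤ C} (adj : T ⊣ N)
    (P : PathObject C) (Q : PathObject D) (κ : N ⋙ P.path ⟶ Q.path ⋙ N)
    (h₀ : ∀ A, κ.app A ≫ N.map (Q.π₀.app A) = P.π₀.app (N.obj A))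
    (h₁ : ∀ A, κ.app A ≫ N.map (Q.π₁.app A) = P.π₁.app (N.obj A)) {X Y : C} (f g : X ⟶ Y)
    (h : P.Homotopic f g) : Q.Homotopic (T.map f) (T.map g) := by
  obtain ⟨h, rfl, rfl⟩ := h
  have k₀ := P.π₀.naturality (adj.unit.app Y)
  have k₁ := P.π₁.naturality (adj.unit.app Y)
  dsimp at k₀ k₁ h₀ h₁
  -- The homotopy is the adjunct of `X ⟶ Y ^ 𝔦[1] ⟶ (N T Y) ^ 𝔦[1] ⟶ N ((T Y) ^ 𝔦[1])`.
  refine ⟨(adj.homEquiv X _).symm (h ≫ P.path.map (adj.unit.app Y) ≫ κ.app (T.obj Y)), ?_, ?_⟩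
  · rw [← adj.homEquiv_naturality_right_symm, Equiv.symm_apply_eq, adj.homEquiv_unit]
    dsimp
    rw [Category.assoc, Category.assoc, h₀, k₀, ← Category.assoc, ← Adjunction.unit_naturality]
  · rw [← adj.homEquiv_naturality_right_symm, Equiv.symm_apply_eq, adj.homEquiv_unit]
    dsimp
    rw [Category.assoc, Category.assoc, h₁, k₁, ← Category.assoc, ← Adjunction.unit_naturality]

end Abstract

/-! ### Homotopies of categories -/

/-- The projection `A × [1] ⥤ A`. -/
def catCylinderProj : catCylinder.{u}.cyl ⟶ 𝟭 Cat.{u, u} where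
  app A := (CategoryTheory.Prod.fst A Bool).toCatHom

/-- The functor `A × [1] × [1] ⥤ A × [1]` given by the meet of `[1]`. -/
def catCylinderMeet : catCylinder.{u}.cyl ⋙ catCylinder.{u}.cyl ⟶ catCylinder.{u}.cyl where
  app A := Functor.toCatHom (C := (A × Bool) × Bool) (D := A × Bool)
    { obj := fun x => (x.1.1, cond x.2 x.1.2 false)
      map := fun {x y} f => (f.1.1, homOfLE (by
        have h₁ := leOfHom f.1.2
        have h₂ := leOfHom f.2
        change cond x.2 x.1.2 false ≤ cond y.2 y.1.2 false
        revert h₁ h₂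
        generalize x.1.2 = a, x.2 = b, y.1.2 = c, y.2 = d
        revert a b c d
        decide)) }

/-- The meet of `[1]` contracts `A × [1]` onto its bottom naturally in `A`, hence compatibly with
`G`, so the cylinder projection is an equivalence. -/
theorem isLocalization_dCatQuotient (G : Type u) [SmallCategory G] :
    (dCatQuotient G).IsLocalization (catEquivalences G) :=
  Cylinder.isLocalization_quotient (catCylinder.diagram G)
    { app := fun X => Functor.whiskerLeft X catCylinderProj
      naturality := fun _ _ f => by
        apply NatTrans.ext; funext g
        exact catCylinderProj.naturality (f.app g) }
    (fun _ => rfl) (fun _ => rfl)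
    (fun X => catCylinder.zigZagEquivalences_proj catCylinderProj catCylinderMeet
      (fun _ => rfl)
      (fun _ => rfl) (fun _ => rfl) G X)

namespace Box

/-- The decomposition `[1]ⁿ⁺¹ ⥤ [1]ⁿ × [1]` that splits off the first coordinate. -/
def splitFirst (n : Box) : Vert (shift.obj n) ⥤ Vert n × Bool where
  obj u := (fun j => u (Fin.succ j), u (0 : Fin (n.dim + 1)))
  map f := (homOfLE fun j => leOfHom f (Fin.succ j), homOfLE (leOfHom f (0 : Fin (n.dim + 1))))

lemma evalFunctor_shift_splitFirst {m n : Box} (φ : m ⟶ n) :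
    evalFunctor (shift.map φ) ⋙ splitFirst n = splitFirst m ⋙ (evalFunctor φ).prod (𝟭 Bool) := by
  refine CategoryTheory.Functor.ext (fun u => Prod.ext (funext fun j => ?_) rfl)
    (fun _ _ _ => Prod.ext (Subsingleton.elim _ _) (Subsingleton.elim _ _))
  change Sum.elim u _ (Sum.map Fin.succ id (φ.coord j)) = Sum.elim _ _ (φ.coord j)
  cases φ.coord j <;> rfl

/-- The vertex of `[1]ⁿ⁺¹` with a given first coordinate. -/
def consVert {n : Box} (b : Bool) (u : Vert n) : Vert (shift.obj n) := Fin.cases b u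

lemma consVert_mono {n : Box} {b b' : Bool} {u u' : Vert n} (hb : b ≤ b') (hu : u ≤ u') :
    consVert b u ≤ consVert b' u' := by
  intro j
  induction j using Fin.cases with
  | zero => exact hb
  | succ j => exact hu j

/-- The functor `[1]ⁿ ⥤ ([1] ⥤ [1]ⁿ⁺¹)` adjoint to the isomorphism `[1]ⁿ × [1] ≅ [1]ⁿ⁺¹`. -/
def consFunctor (n : Box) : Vert n ⥤ Bool ⥤ Vert (shift.obj n) where
  obj u :=
    { obj := fun b => consVert b u
      map := fun f => homOfLE (consVert_mono (leOfHom f) le_rfl) }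
  map f := { app := fun _ => homOfLE (consVert_mono le_rfl (leOfHom f)) }

lemma evalFunctor_comp_consFunctor {m n : Box} (φ : m ⟶ n) :
    evalFunctor φ ⋙ consFunctor n = consFunctor m ⋙
      (Functor.whiskeringRight Bool _ _).obj (evalFunctor (shift.map φ)) := by
  refine CategoryTheory.Functor.ext (fun u => CategoryTheory.Functor.ext (fun b => funext fun j => ?_)
    (fun _ _ _ => Subsingleton.elim _ _)) (fun _ _ _ => ?_)
  · induction j using Fin.cases with
    | zero => rfl
    | succ j =>
      change Sum.elim u _ (φ.coord j) = Sum.elim _ _ (Sum.map Fin.succ id (φ.coord j))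
      cases φ.coord j <;> rfl
  · ext
    exact Subsingleton.elim _ _

lemma consFunctor_evaluation (ε : Bool) (n : Box) :
    consFunctor n ⋙ (evaluation Bool _).obj ε = evalFunctor ((coface ε).app n) := by
  refine CategoryTheory.Functor.ext (fun u => funext fun j => ?_)
    (fun _ _ _ => Subsingleton.elim _ _)
  induction j using Fin.cases with
  | zero => cases ε <;> rfl
  | succ j => rfl

end Box

/-- The prism `ner A ⟶ (ner (A × [1])) ^ □[1]`. -/
def nerPrism : ner.{u} ⟶ catCylinder.cyl ⋙ ner ⋙ cubicalPath.path where
  app A :=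
    { app := fun n => TypeCat.ofHom fun F : Box.Vert n.unop ⥤ A =>
        (Box.splitFirst n.unop ⋙ F.prod (𝟭 Bool) :)
      naturality := fun m n f => by
        ext F
        exact congrArg (· ⋙ F.prod (𝟭 Bool)) (Box.evalFunctor_shift_splitFirst f.unop).symm }
  naturality A B Φ := rfl

lemma ner_homotopic (G : Type u) [SmallCategory G] {A B : G ⥤ Cat.{u, u}} (f g : A ⟶ B)
    (h : catHomotopic G f g) :
    (cubicalPath.diagram G).Homotopic ((nerDiagram G).map f) ((nerDiagram G).map g) :=
  PathObject.homotopic_map_of_cylinder catCylinder cubicalPath ner nerPrism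
    (fun _ => rfl) (fun _ => rfl) G f g h

/-- The path object `A ↦ A ^ [1]` of small categories. -/
def catPath : PathObject Cat.{u, u} where
  path :=
    { obj := fun A => Cat.of (Bool ⥤ A)
      map := fun Φ => ((Functor.whiskeringRight Bool _ _).obj Φ.toFunctor).toCatHom }
  π₀ := { app := fun A => ((evaluation Bool A).obj false).toCatHom }
  π₁ := { app := fun A => ((evaluation Bool A).obj true).toCatHom }

/-- The evaluation functor `A ^ [1] × [1] ⥤ A`. -/
def catPathEval : catPath.{u}.path ⋙ catCylinder.cyl ⟶ 𝟭 Cat.{u, u} where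
  app A := Functor.toCatHom (C := (Bool ⥤ A) × Bool)
    { obj := fun p => p.1.obj p.2
      map := fun {p _} f => p.1.map f.2 ≫ f.1.app _ }
  naturality A B Φ := by
    refine Cat.Hom.ext (CategoryTheory.Functor.ext (fun _ => rfl) (fun p q f => ?_))
    change Φ.toFunctor.map (p.1.map f.2) ≫ Φ.toFunctor.map (f.1.app q.2) = 𝟙 _ ≫ _ ≫ 𝟙 _
    rw [Category.id_comp, Category.comp_id, ← Functor.map_comp]
    rfl

lemma catPathEval_end (ε : Bool) (A : Cat.{u, u}) :
    (Prod.sectL (Bool ⥤ A) ε).toCatHom ≫ catPathEval.app A =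
      ((evaluation Bool A).obj ε).toCatHom := by
  have (p q : Bool ⥤ A) (f : p ⟶ q) : p.map (𝟙 ε) ≫ f.app ε = 𝟙 _ ≫ f.app ε ≫ 𝟙 _ := by simp
  exact Cat.Hom.ext (CategoryTheory.Functor.ext (fun _ => rfl) this)

/-- The comparison `(ner A) ^ □[1] ⟶ ner (A ^ [1])`. -/
def nerPathComparison : ner.{u} ⋙ cubicalPath.path ⟶ catPath.path ⋙ ner where
  app A :=
    { app := fun n => TypeCat.ofHom fun F : Box.Vert (Box.shift.obj n.unop) ⥤ A =>
        (Box.consFunctor n.unop ⋙ (Functor.whiskeringRight Bool _ _).obj F :)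
      naturality := fun m n f => by
        ext F
        exact congrArg (· ⋙ (Functor.whiskeringRight Bool _ _).obj F)
          (Box.evalFunctor_comp_consFunctor f.unop).symm }
  naturality A B Φ := rfl

/-- Left adjoints are seen to preserve homotopies in path object form; evaluation `A ^ [1] × [1] ⥤
A` converts the result to the cylinder form. -/
lemma catHomotopic_of_path (G : Type u) [SmallCategory G] {A B : G ⥤ Cat.{u, u}} (f g : A ⟶ B)
    (h : (catPath.diagram G).Homotopic f g) : catHomotopic G f g :=
  Cylinder.homotopic_map_of_pathObject catPath catCylinder (𝟭 Cat.{u, u}) catPathEval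
    (catPathEval_end false) (catPathEval_end true) G f g h

/-- A left adjoint of the nerve sends cubical homotopies of diagrams to homotopies. -/
lemma catHomotopic_of_adjunction {T : CubicalSet.{u} ⥤ Cat.{u, u}} (adj : T ⊣ ner)
    (G : Type u) [SmallCategory G] {X Y : G ⥤ CubicalSet.{u}} (f g : X ⟶ Y)
    (h : (cubicalPath.diagram G).Homotopic f g) :
    catHomotopic G (((Functor.whiskeringRight G _ _).obj T).map f)
      (((Functor.whiskeringRight G _ _).obj T).map g) := by
  refine catHomotopic_of_path G _ _ (PathObject.homotopic_map_of_adjunction (adj.whiskerRight G)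
    (cubicalPath.diagram G) (catPath.diagram G)
    { app := fun A => Functor.whiskerLeft A nerPathComparison
      naturality := fun A B f => by
        apply NatTrans.ext; funext i
        exact nerPathComparison.naturality (f.app i) } (fun A => ?_) (fun A => ?_) f g h)
  · apply NatTrans.ext; funext i
    apply NatTrans.ext; funext n
    ext F
    exact congrArg (· ⋙ (F : Box.Vert (Box.shift.obj n.unop) ⥤ A.obj i))
      (Box.consFunctor_evaluation false n.unop)
  · apply NatTrans.ext; funext i
    apply NatTrans.ext; funext n
    ext F
    exact congrArg (· ⋙ (F : Box.Vert (Box.shift.obj n.unop) ⥤ A.obj i))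
      (Box.consFunctor_evaluation true n.unop)

/-! ### The fundamental category -/

namespace Box

/-- The cubes `[1]ⁿ` as small categories. -/
def toCat : Box ⥤ Cat.{u, u} where
  obj n := Cat.of (AsSmall.{u} (Vert n))
  map φ := (AsSmall.down ⋙ evalFunctor φ ⋙ AsSmall.up).toCatHom
  map_id _ := rfl
  map_comp f g := by
    rw [evalFunctor_comp]
    rfl

end Box

/-- The cubical nerve as a restricted Yoneda functor. -/
def nerIsoRestrictedYoneda :
    Presheaf.restrictedULiftYoneda.{0} Box.toCat.{u} ≅ ner.{u} :=
  NatIso.ofComponents (fun A => NatIso.ofComponents (fun n => Equiv.toIso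
    { toFun := fun F => (AsSmall.up ⋙ F.down.toFunctor : Box.Vert n.unop ⥤ A)
      invFun := fun F => ⟨(AsSmall.down ⋙ F).toCatHom⟩
      left_inv := fun _ => rfl
      right_inv := fun _ => rfl }) (fun _ => rfl)) (fun _ => rfl)

/-- Since `Cat` is cocomplete, `□ ⥤ Cat` has a left Kan extension along the Yoneda embedding, and
this is left adjoint to the restricted Yoneda functor. -/
instance ner_isRightAdjoint : ner.{u}.IsRightAdjoint := by
  have : Limits.HasColimitsOfSize.{0, u} Cat.{u, u} :=
    Limits.hasColimitsOfSizeShrink.{0, u, u, u} Cat.{u, u}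
  have : (uliftYoneda.{u} : Box ⥤ _).HasPointwiseLeftKanExtension Box.toCat.{u} := inferInstance
  have := (Presheaf.uliftYonedaAdjunction.{0} _
    ((uliftYoneda.{u} : Box ⥤ _).leftKanExtensionUnit Box.toCat.{u})).isRightAdjoint
  exact Functor.isRightAdjoint_of_iso nerIsoRestrictedYoneda

/-! ### The cubical nerve is fully faithful -/

namespace Box

/-- The vertex that agrees with `w` off the coordinate `i`, where it is `b`. -/
def setCoord {n : Box} (w : Vert n) (i : Fin n.dim) (b : Bool) : Vert n :=
  fun j => if j = i then b else w j

lemma setCoord_le {n : Box} (w : Vert n) (i : Fin n.dim) :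
    setCoord w i false ≤ setCoord w i true := by
  intro j
  unfold setCoord
  split
  · exact Bool.false_le _
  · exact le_rfl

/-- The edge of `[1]ⁿ` through the vertices that agree with `w` off the coordinate `i`. -/
def edge {n : Box} (w : Vert n) (i : Fin n.dim) : (⟨1⟩ : Box) ⟶ n where
  coord j := if j = i then Sum.inl 0 else Sum.inr (w j)
  inj := by
    intro j j' k h h'
    by_cases hj : j = i <;> by_cases hj' : j' = i <;> simp_all

/-- The vertex `w` of `[1]ⁿ` as a morphism. -/
def point {n : Box} (w : Vert n) : (⟨0⟩ : Box) ⟶ n where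
  coord j := Sum.inr (w j)
  inj := by simp

/-- The codegeneracy `[1] ⟶ [0]`. -/
def codegeneracy : (⟨1⟩ : Box) ⟶ ⟨0⟩ where
  coord j := j.elim0
  inj j := j.elim0

/-- The vertices of `[1]¹`. -/
def vert₁ (b : Bool) : Vert ⟨1⟩ := fun _ => b

lemma vert₁_le : vert₁ false ≤ vert₁ true := fun _ => Bool.false_le _

/-- The vertex of `[1]⁰`. -/
def vert₀ : Vert ⟨0⟩ := fun j => j.elim0

lemma eval_edge {n : Box} (w : Vert n) (i : Fin n.dim) (b : Bool) :
    eval (edge w i) Bool (vert₁ b) = setCoord w i b := by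
  funext j
  change Sum.elim _ _ (if j = i then _ else _) = if j = i then _ else _
  split
  · rfl
  · dsimp only
    cases w j <;> rfl

lemma eval_point {n : Box} (w : Vert n) (u : Vert ⟨0⟩) : eval (point w) Bool u = w := by
  funext j
  change (if w j then (⊤ : Bool) else ⊥) = w j
  cases w j <;> rfl

end Box

/-! ### Functors on `[1]ⁿ` and their edges. -/

section Cubes

variable {A : Type*} [Category A]

/-- The arrow given by a functor on `[1]ⁿ` and two comparable vertices. -/
def cubeArrow {n : Box} (c : Box.Vert n ⥤ A) {u v : Box.Vert n} (h : u ≤ v) : Arrow A :=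
  Arrow.mk (c.map (homOfLE h))

/-- Morphisms are compared as objects of `Arrow A`, so that end points which agree only
propositionally need no transport. -/
lemma cubeArrow_congr {n : Box} (c : Box.Vert n ⥤ A) {u v u' v' : Box.Vert n} (h : u ≤ v)
    (h' : u' ≤ v') (hu : u = u') (hv : v = v') : cubeArrow c h = cubeArrow c h' := by
  subst hu hv
  rfl

lemma cubeArrow_self {n : Box} (c : Box.Vert n ⥤ A) {u v : Box.Vert n} (h : u ≤ v) (e : u = v) :
    cubeArrow c h = Arrow.mk (𝟙 (c.obj u)) := by
  subst e
  exact congrArg Arrow.mk (c.map_id u)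

lemma cubeArrow_evalFunctor {m n : Box} (φ : m ⟶ n) (c : Box.Vert n ⥤ A) {u v : Box.Vert m}
    (h : u ≤ v) {u' v' : Box.Vert n} (h' : u' ≤ v') (hu : Box.eval φ Bool u = u')
    (hv : Box.eval φ Bool v = v') : cubeArrow (Box.evalFunctor φ ⋙ c) h = cubeArrow c h' := by
  subst hu hv
  rfl

lemma arrow_mk_comp_congr {x y z x' y' z' : A} {f : x ⟶ y} {g : y ⟶ z} {f' : x' ⟶ y'}
    {g' : y' ⟶ z'} (hf : Arrow.mk f = Arrow.mk f') (hg : Arrow.mk g = Arrow.mk g') :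
    Arrow.mk (f ≫ g) = Arrow.mk (f' ≫ g') := by
  rw [Arrow.mk_eq_mk_iff] at hf hg ⊢
  obtain ⟨rfl, rfl, rfl⟩ := hf
  obtain ⟨_, rfl, rfl⟩ := hg
  exact ⟨rfl, rfl, by simp⟩

lemma cubeArrow_comp_congr {n : Box} (c c' : Box.Vert n ⥤ A) {u v w : Box.Vert n} (h : u ≤ v)
    (h' : v ≤ w) (e : cubeArrow c h = cubeArrow c' h) (e' : cubeArrow c h' = cubeArrow c' h') :
    cubeArrow c (h.trans h') = cubeArrow c' (h.trans h') := by
  have : homOfLE (h.trans h') = homOfLE h ≫ homOfLE h' := rfl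
  unfold cubeArrow
  rw [this, c.map_comp, c'.map_comp]
  exact arrow_mk_comp_congr e e'

/-- Two functors on `[1]ⁿ` agree if they agree on the edges. -/
lemma vertFunctor_ext {n : Box} (F F' : Box.Vert n ⥤ A) (h₀ : ∀ w, F.obj w = F'.obj w)
    (h : ∀ (w : Box.Vert n) (i : Fin n.dim),
      cubeArrow F (Box.setCoord_le w i) = cubeArrow F' (Box.setCoord_le w i)) : F = F' := by
  -- Induction on a set `S` off which `u` and `v` agree. The inequality is factored through the
  -- vertex `Box.setCoord v i (u i)`: the first factor changes only coordinates in the smaller set,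
  -- the second is an identity or an edge.
  have key : ∀ (S : Finset (Fin n.dim)) (u v : Box.Vert n) (f : u ≤ v),
      (∀ i, i ∉ S → u i = v i) → cubeArrow F f = cubeArrow F' f := by
    intro S
    induction S using Finset.induction_on with
    | empty =>
      intro u v f huv
      have e : u = v := funext fun i => huv i (by simp)
      rw [cubeArrow_self F f e, cubeArrow_self F' f e, h₀]
    | insert i S hi ih =>
      intro u v hle huv
      have h₁ : u ≤ Box.setCoord v i (u i) := by
        intro j
        by_cases hj : j = i
        · subst hj; simp [Box.setCoord]
        · simpa [Box.setCoord, hj] using hle j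
      have h₂ : Box.setCoord v i (u i) ≤ v := by
        intro j
        by_cases hj : j = i
        · subst hj; simpa [Box.setCoord] using hle j
        · simp [Box.setCoord, hj]
      have e₁ := ih u _ h₁ (by
        intro j hj
        by_cases hj' : j = i
        · subst hj'; simp [Box.setCoord]
        · simpa [Box.setCoord, hj'] using huv j (by simp [hj, hj']))
      refine cubeArrow_comp_congr F F' h₁ h₂ e₁ ?_
      by_cases hc : u i = v i
      · have e : Box.setCoord v i (u i) = v := by
          funext j
          by_cases hj : j = i
          · subst hj; simp [Box.setCoord, hc]
          · simp [Box.setCoord, hj]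
        rw [cubeArrow_self F h₂ e, cubeArrow_self F' h₂ e, h₀]
      · have huv : u i = false ∧ v i = true := by
          have : @LE.le Bool _ (u i) (v i) := hle i
          revert this hc
          generalize u i = a, v i = b
          revert a b
          decide
        have e : v = Box.setCoord v i true := by
          funext j
          by_cases hj : j = i
          · subst hj; simp [Box.setCoord, huv.2]
          · simp [Box.setCoord, hj]
        have e' : Box.setCoord v i (u i) = Box.setCoord v i false := by rw [huv.1]
        rw [cubeArrow_congr F h₂ (Box.setCoord_le v i) e' e,
          cubeArrow_congr F' h₂ (Box.setCoord_le v i) e' e]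
        exact h v i
  refine Arrow.functor_ext fun u v f => ?_
  exact key Finset.univ u v (leOfHom f) (by simp)

/-- The `1`-cube given by an arrow. -/
def edgeCube {x y : A} (f : x ⟶ y) : Box.Vert ⟨1⟩ ⥤ A :=
  Monotone.functor (X := Box.Vert ⟨1⟩) (f := fun u => (if u 0 then 1 else 0 : Fin 2)) (by
    intro u v h
    have := h 0
    revert this
    change u 0 ≤ v 0 → _
    dsimp only
    generalize u 0 = a, v 0 = b
    revert a b
    decide) ⋙ ComposableArrows.mk₁ f

/-- The `2`-cube with sides `f`, `g` and `f ≫ g`, `𝟙`. -/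
def compCube {x y z : A} (f : x ⟶ y) (g : y ⟶ z) : Box.Vert ⟨2⟩ ⥤ A :=
  Monotone.functor (X := Box.Vert ⟨2⟩)
    (f := fun u => (if u 1 then 2 else if u 0 then 1 else 0 : Fin 3)) (by
    intro u v h
    have h₀ := h 0
    have h₁ := h 1
    revert h₀ h₁
    change u 0 ≤ v 0 → u 1 ≤ v 1 → _
    dsimp only
    generalize u 0 = a, v 0 = b, u 1 = c, v 1 = d
    revert a b c d
    decide) ⋙ ComposableArrows.mk₂ f g

lemma cubeArrow_edgeCube {x y : A} (f : x ⟶ y) :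
    cubeArrow (edgeCube f) Box.vert₁_le = Arrow.mk f := rfl

end Cubes

/-! ### Functors recovered from cubical functions of nerves. -/

section FullyFaithful

variable {A B : Cat.{u, u}}

/-- A cubical function of nerves on `n`-cubes. -/
def nerApp (ψ : ner.obj A ⟶ ner.obj B) {n : Box} (c : Box.Vert n ⥤ A) : Box.Vert n ⥤ B :=
  ψ.app (op n) c

lemma nerApp_comp (ψ : ner.obj A ⟶ ner.obj B) {m n : Box} (φ : m ⟶ n) (c : Box.Vert n ⥤ A) :
    nerApp ψ (Box.evalFunctor φ ⋙ c) = Box.evalFunctor φ ⋙ nerApp ψ c :=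
  NatTrans.naturality_apply ψ φ.op c

/-- The effect of a cubical function of nerves on objects. -/
def nerPreimageObj (ψ : ner.obj A ⟶ ner.obj B) (a : A) : B :=
  (nerApp ψ ((Functor.const (Box.Vert ⟨0⟩)).obj a)).obj Box.vert₀

/-- Naturality along the vertex `Box.point u : [1]⁰ ⟶ [1]ⁿ` reduces the claim to `0`-cubes. -/
lemma nerApp_obj (ψ : ner.obj A ⟶ ner.obj B) {n : Box} (c : Box.Vert n ⥤ A) (u : Box.Vert n) :
    (nerApp ψ c).obj u = nerPreimageObj ψ (c.obj u) := by
  have e : Box.evalFunctor (Box.point u) ⋙ c = (Functor.const (Box.Vert ⟨0⟩)).obj (c.obj u) :=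
    CategoryTheory.Functor.ext (fun w => congrArg c.obj (Box.eval_point u w)) (fun w w' f => by
      obtain rfl : w = w' := funext fun j => j.elim0
      obtain rfl : f = 𝟙 w := Subsingleton.elim _ _
      simp)
  rw [nerPreimageObj, ← e, nerApp_comp]
  exact congrArg _ (Box.eval_point u Box.vert₀).symm

/-- The effect of a cubical function of nerves on arrows. -/
def nerPreimageMap (ψ : ner.obj A ⟶ ner.obj B) {a b : A} (f : a ⟶ b) :
    nerPreimageObj ψ a ⟶ nerPreimageObj ψ b :=
  eqToHom (nerApp_obj ψ (edgeCube f) (Box.vert₁ false)).symm ≫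
    (nerApp ψ (edgeCube f)).map (homOfLE Box.vert₁_le) ≫
      eqToHom (nerApp_obj ψ (edgeCube f) (Box.vert₁ true))

lemma arrow_nerPreimageMap (ψ : ner.obj A ⟶ ner.obj B) {a b : A} (f : a ⟶ b) :
    Arrow.mk (nerPreimageMap ψ f) = cubeArrow (nerApp ψ (edgeCube f)) Box.vert₁_le := by
  exact (Arrow.mk_eq_mk_iff _ _).2 ⟨(nerApp_obj ψ (edgeCube f) (Box.vert₁ false)).symm,
    (nerApp_obj ψ (edgeCube f) (Box.vert₁ true)).symm, rfl⟩

lemma edgeCube_congr {A : Type*} [Category A] {x y x' y' : A} {f : x ⟶ y} {f' : x' ⟶ y'}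
    (h : Arrow.mk f = Arrow.mk f') : edgeCube f = edgeCube f' := by
  change edgeCube (Arrow.mk f).hom = edgeCube (Arrow.mk f').hom
  rw [h]

lemma eq_edgeCube {A : Type*} [Category A] (c : Box.Vert ⟨1⟩ ⥤ A) :
    c = edgeCube (c.map (homOfLE Box.vert₁_le)) := by
  have e (w : Box.Vert ⟨1⟩) (b : Bool) : Box.setCoord w 0 b = Box.vert₁ b :=
    funext fun j => by rw [Subsingleton.elim j (0 : Fin 1)]; rfl
  refine vertFunctor_ext _ _ (fun w => ?_) (fun w i => ?_)
  · obtain ⟨b, rfl⟩ : ∃ b, w = Box.vert₁ b :=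
      ⟨w (0 : Fin 1), funext fun j => by rw [Subsingleton.elim j (0 : Fin 1)]; rfl⟩
    cases b <;> rfl
  · obtain rfl : i = 0 := Subsingleton.elim _ _
    rw [cubeArrow_congr _ _ Box.vert₁_le (e w _) (e w _),
      cubeArrow_congr _ _ Box.vert₁_le (e w _) (e w _), cubeArrow_edgeCube]
    rfl

/-- Naturality along an edge of `[1]ⁿ` reduces the claim to `1`-cubes, each of which is an
`edgeCube`. -/
lemma cubeArrow_nerApp (ψ : ner.obj A ⟶ ner.obj B) {n : Box} (c : Box.Vert n ⥤ A)
    (w : Box.Vert n) (i : Fin n.dim) {a b : A} {f : a ⟶ b}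
    (h : cubeArrow c (Box.setCoord_le w i) = Arrow.mk f) :
    cubeArrow (nerApp ψ c) (Box.setCoord_le w i) = Arrow.mk (nerPreimageMap ψ f) := by
  rw [← cubeArrow_evalFunctor (Box.edge w i) _ Box.vert₁_le _ (Box.eval_edge w i false)
    (Box.eval_edge w i true)] at h ⊢
  rw [← nerApp_comp, arrow_nerPreimageMap, eq_edgeCube (Box.evalFunctor (Box.edge w i) ⋙ c),
    edgeCube_congr h]

/-- The `1`-cube of an identity is degenerate, and naturality along the codegeneracy keeps it so. -/
lemma nerPreimageMap_id (ψ : ner.obj A ⟶ ner.obj B) (a : A) :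
    nerPreimageMap ψ (𝟙 a) = 𝟙 (nerPreimageObj ψ a) := by
  have e : edgeCube (𝟙 a) = Box.evalFunctor Box.codegeneracy ⋙
      (Functor.const (Box.Vert ⟨0⟩)).obj a :=
    (eq_edgeCube (Box.evalFunctor Box.codegeneracy ⋙ (Functor.const (Box.Vert ⟨0⟩)).obj a)).symm
  have := arrow_nerPreimageMap ψ (𝟙 a)
  rw [e, nerApp_comp] at this
  have e' : Box.eval Box.codegeneracy Bool (Box.vert₁ false) =
      Box.eval Box.codegeneracy Bool (Box.vert₁ true) := funext fun j => j.elim0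
  rw [cubeArrow_evalFunctor Box.codegeneracy _ _ (le_of_eq (α := Box.Vert ⟨0⟩) e') rfl rfl,
    cubeArrow_self _ _ e'] at this
  have e'' : (nerApp ψ ((Functor.const (Box.Vert ⟨0⟩)).obj a)).obj
      (Box.eval Box.codegeneracy Bool (Box.vert₁ false)) = nerPreimageObj ψ a := nerApp_obj ψ _ _
  obtain ⟨_, _, h⟩ := (Arrow.mk_eq_mk_iff _ _).1
    (this.trans (congrArg (fun b => Arrow.mk (𝟙 b)) e''))
  simpa using h

/-- The image of the square `compCube f g` commutes. One way around it gives the images of `f` and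
`g`, the other the image of `f ≫ g` followed by that of an identity. -/
lemma nerPreimageMap_comp (ψ : ner.obj A ⟶ ner.obj B) {a b c : A} (f : a ⟶ b) (g : b ⟶ c) :
    nerPreimageMap ψ (f ≫ g) = nerPreimageMap ψ f ≫ nerPreimageMap ψ g := by
  let w (i j : Bool) : Box.Vert ⟨2⟩ := fun k : Fin 2 => if k = 0 then i else j
  have hw₀ (i j k : Bool) : Box.setCoord (w i j) (0 : Fin 2) k = w k j := by
    funext (l : Fin 2); fin_cases l <;> rfl
  have hw₁ (i j k : Bool) : Box.setCoord (w i j) (1 : Fin 2) k = w i k := by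
    funext (l : Fin 2); fin_cases l <;> rfl
  have le₀ (j : Bool) : w false j ≤ w true j := by
    have := Box.setCoord_le (w false j) (0 : Fin 2)
    rwa [hw₀, hw₀] at this
  have le₁ (i : Bool) : w i false ≤ w i true := by
    have := Box.setCoord_le (w i false) (1 : Fin 2)
    rwa [hw₁, hw₁] at this
  have k₀ {D : Type u} [SmallCategory D] (R : Box.Vert ⟨2⟩ ⥤ D) (j : Bool) :
      cubeArrow R (le₀ j) = cubeArrow R (Box.setCoord_le (w false j) (0 : Fin 2)) :=
    cubeArrow_congr _ _ _ (hw₀ _ _ _).symm (hw₀ _ _ _).symm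
  have k₁ {D : Type u} [SmallCategory D] (R : Box.Vert ⟨2⟩ ⥤ D) (i : Bool) :
      cubeArrow R (le₁ i) = cubeArrow R (Box.setCoord_le (w i false) (1 : Fin 2)) :=
    cubeArrow_congr _ _ _ (hw₁ _ _ _).symm (hw₁ _ _ _).symm
  let Q := compCube f g
  have h₁ : cubeArrow (nerApp ψ Q) (le₀ false) = Arrow.mk (nerPreimageMap ψ f) := by
    rw [k₀]; exact cubeArrow_nerApp ψ Q _ _ (by rw [← k₀]; rfl)
  have h₂ : cubeArrow (nerApp ψ Q) (le₁ true) = Arrow.mk (nerPreimageMap ψ g) := by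
    rw [k₁]; exact cubeArrow_nerApp ψ Q _ _ (by rw [← k₁]; rfl)
  have h₃ : cubeArrow (nerApp ψ Q) (le₁ false) = Arrow.mk (nerPreimageMap ψ (f ≫ g)) := by
    rw [k₁]; exact cubeArrow_nerApp ψ Q _ _ (by rw [← k₁]; rfl)
  have h₄ : cubeArrow (nerApp ψ Q) (le₀ true) = Arrow.mk (nerPreimageMap ψ (𝟙 c)) := by
    rw [k₀]; exact cubeArrow_nerApp ψ Q _ _ (by
      rw [← k₀]; exact congrArg Arrow.mk ((ComposableArrows.mk₂ f g).map_id 2))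
  have e₁ := arrow_mk_comp_congr h₁ h₂
  have e₂ := arrow_mk_comp_congr h₃ h₄
  rw [← Functor.map_comp] at e₁ e₂
  have e := e₂.symm.trans e₁
  rw [nerPreimageMap_id, Category.comp_id, Arrow.mk_eq_mk_iff] at e
  obtain ⟨_, _, e⟩ := e
  simpa using e

/-- The functor underlying a cubical function of nerves. -/
def nerPreimage (ψ : ner.obj A ⟶ ner.obj B) : A ⥤ B where
  obj := nerPreimageObj ψ
  map := nerPreimageMap ψ
  map_id := nerPreimageMap_id ψ
  map_comp := nerPreimageMap_comp ψ

instance ner_full : ner.{u}.Full where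
  map_surjective {A B} ψ := by
    refine ⟨(nerPreimage ψ).toCatHom, ?_⟩
    apply NatTrans.ext; funext n
    ext c
    change (c : Box.Vert n.unop ⥤ A) ⋙ nerPreimage ψ = nerApp ψ c
    refine vertFunctor_ext _ _ (fun w => (nerApp_obj ψ c w).symm) (fun w i => ?_)
    exact (cubeArrow_nerApp ψ c w i rfl).symm

instance ner_faithful : ner.{u}.Faithful where
  map_injective {A B} Φ Ψ h := by
    refine Cat.Hom.ext (Arrow.functor_ext fun a b f => ?_)
    have := congrArg (fun ψ => cubeArrow (nerApp ψ (edgeCube f)) Box.vert₁_le) h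
    exact this

end FullyFaithful

/-! ### Maps of directed cubes -/

/-- The point of `Iⁿ⁺¹` with a given first coordinate. -/
def consPoint {n : ℕ} (t : I) (s : Fin n → I) : Fin (n + 1) → I := Fin.cases t s

lemma continuous_consPoint {n : ℕ} :
    Continuous fun p : I × (Fin n → I) => consPoint p.1 p.2 := by
  refine continuous_pi fun j => ?_
  induction j using Fin.cases with
  | zero => exact continuous_fst
  | succ j => exact (continuous_apply j).comp continuous_snd

lemma consPoint_mono {n : ℕ} {t t' : I} {s s' : Fin n → I} (ht : t ≤ t') (hs : s ≤ s') :
    consPoint t s ≤ consPoint t' s' := by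
  intro j
  induction j using Fin.cases with
  | zero => exact ht
  | succ j => exact hs j

lemma exists_consPoint_of_mem_Icc {n : ℕ} {t t' : I} {s s' : Fin n → I} {z : Fin (n + 1) → I}
    (hz : z ∈ Set.Icc (consPoint t s) (consPoint t' s')) :
    ∃ a ∈ Set.Icc t t', ∃ b ∈ Set.Icc s s', z = consPoint a b := by
  refine ⟨z 0, ⟨hz.1 0, hz.2 0⟩, fun j => z j.succ, ⟨fun j => hz.1 j.succ, fun j => hz.2 j.succ⟩, ?_⟩
  funext j
  induction j using Fin.cases <;> rfl

lemma consPoint_eta {n : ℕ} (z : Fin (n + 1) → I) : consPoint (z 0) (fun j => z j.succ) = z := by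
  funext j
  induction j using Fin.cases <;> rfl

lemma continuous_eval {m n : Box} (φ : m ⟶ n) : Continuous (Box.eval φ I) := by
  refine continuous_pi fun j => ?_
  change Continuous fun x : Fin m.dim → I => Sum.elim x _ (φ.coord j)
  cases φ.coord j with
  | inl i => exact continuous_apply i
  | inr b => exact continuous_const

lemma eval_shift_consPoint {m n : Box} (φ : m ⟶ n) (t : I) (s : Fin m.dim → I) :
    Box.eval (Box.shift.map φ) I (consPoint t s) = consPoint t (Box.eval φ I s) := by
  funext j
  induction j using Fin.cases with
  | zero => rfl
  | succ j =>
    change Sum.elim _ _ (Sum.map Fin.succ id (φ.coord j)) = Sum.elim s _ (φ.coord j)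
    cases φ.coord j <;> rfl

lemma eval_coface_point (ε : Bool) {n : Box} (s : Fin n.dim → I) :
    Box.eval ((Box.coface ε).app n) I s = consPoint (if ε then 1 else 0) s := by
  funext j
  induction j using Fin.cases with
  | zero => rfl
  | succ j => rfl

/-- The image of an order interval under a morphism of `□` is an order interval. -/
lemma exists_eval_of_mem_Icc {m n : Box} (φ : m ⟶ n) {P : Type*} [PartialOrder P] [BoundedOrder P]
    {x y : Fin m.dim → P} (hxy : x ≤ y) {z : Fin n.dim → P}
    (hz : z ∈ Set.Icc (Box.eval φ P x) (Box.eval φ P y)) :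
    ∃ w ∈ Set.Icc x y, Box.eval φ P w = z ∧ ∀ i, (∀ j, φ.coord j ≠ Sum.inl i) → w i = x i := by
  classical
  -- An input coordinate `i` feeds at most one output coordinate, by injectivity, and that one
  -- prescribes `w i`. Unused inputs stay at `x i`.
  refine ⟨fun i => if h : ∃ j, φ.coord j = Sum.inl i then z h.choose else x i, ⟨?_, ?_⟩, ?_,
    fun i hi => dif_neg fun ⟨j, hj⟩ => hi j hj⟩
  · intro i
    dsimp only
    split_ifs with h
    · have := hz.1 h.choose
      unfold Box.eval at this
      rwa [h.choose_spec] at this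
    · exact le_rfl
  · intro i
    dsimp only
    split_ifs with h
    · have := hz.2 h.choose
      unfold Box.eval at this
      rwa [h.choose_spec] at this
    · exact hxy i
  · funext j
    have h₁ := hz.1 j
    have h₂ := hz.2 j
    unfold Box.eval at h₁ h₂ ⊢
    rcases hj : φ.coord j with i | b
    · have h : ∃ j, φ.coord j = Sum.inl i := ⟨j, hj⟩
      simp only [Sum.elim_inl, dif_pos h]
      rw [φ.inj h.choose_spec hj]
    · rw [hj] at h₁ h₂
      exact le_antisymm h₁ h₂

lemma cubeCirc_rel_of_le {n : ℕ} {U : Opens (Fin n → I)} {x y : Fin n → I} (h : x ≤ y)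
    (hU : ∀ z ∈ Set.Icc x y, z ∈ U) : (cubeCirc n).rel U x y :=
  ⟨hU x ⟨le_rfl, h⟩, .single ⟨h, hU⟩⟩

lemma intervalCirc_rel_of_le {U : Opens I} {x y : I} (h : x ≤ y)
    (hU : ∀ z ∈ Set.Icc x y, z ∈ U) : intervalCirc.rel U x y :=
  ⟨hU x ⟨le_rfl, h⟩, .single ⟨h, hU⟩⟩

/-! ### Singular cubes of streams -/

/-- A stream map from the directed `n`-cube to a stream. -/
@[ext]
structure SingCube (X : Strm.{u}) (n : Box) : Type u where
  toFun : C(Fin n.dim → I, X)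
  map_rel : ∀ (V : Opens X) (x y : Fin n.dim → I), x ≤ y → (∀ z ∈ Set.Icc x y, toFun z ∈ V) →
    X.circ.rel V (toFun x) (toFun y)

/-- The restriction of a singular cube along a morphism of `□`. -/
def SingCube.precomp {X : Strm.{u}} {m n : Box} (φ : m ⟶ n) (γ : SingCube X n) : SingCube X m where
  toFun := γ.toFun.comp ⟨Box.eval φ I, continuous_eval φ⟩
  map_rel V x y h hV := γ.map_rel V _ _ (Box.eval_mono I φ h) (by
    intro z hz
    obtain ⟨w, hw, rfl, -⟩ := exists_eval_of_mem_Icc φ h hz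
    exact hV w hw)

/-- The image of a singular cube under a stream map. -/
def SingCube.postcomp {X Y : Strm.{u}} {n : Box} (f : X ⟶ Y) (γ : SingCube X n) :
    SingCube Y n where
  toFun := f.toFun.comp γ.toFun
  map_rel V x y h hV := f.map_rel V _ _ (γ.map_rel _ x y h hV)

/-- The singular cubical set of a stream. -/
def sing : Strm.{u} ⥤ CubicalSet.{u} where
  obj X :=
    { obj := fun n => SingCube X n.unop
      map := fun φ => TypeCat.ofHom fun γ => γ.precomp φ.unop
      map_id := fun _ => rfl
      map_comp := fun f g => by
        ext γ s
        exact congrArg γ.toFun (Box.eval_comp I g.unop f.unop s) }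
  map f := { app := fun _ => TypeCat.ofHom fun γ => γ.postcomp f }

/-- The prism `γ × I` of a singular cube. -/
def SingCube.prism {X : Strm.{u}} {n : Box} (γ : SingCube X n) :
    SingCube X.cylObj (Box.shift.obj n) where
  toFun := ⟨fun z : Fin (n.dim + 1) → I => ((γ.toFun fun j => z j.succ, z 0) : X × I),
    by fun_prop⟩
  map_rel V x y h hV := by
    let x' : Fin n.dim → I := fun j => x (Fin.succ j)
    let y' : Fin n.dim → I := fun j => y (Fin.succ j)
    have hx : consPoint (x (0 : Fin (n.dim + 1))) x' = x := consPoint_eta x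
    have hy : consPoint (y (0 : Fin (n.dim + 1))) y' = y := consPoint_eta y
    have hh : x' ≤ y' := fun j => h (Fin.succ j)
    have h0 : x (0 : Fin (n.dim + 1)) ≤ y (0 : Fin (n.dim + 1)) := h (0 : Fin (n.dim + 1))
    have key (a : I) (ha : a ∈ Set.Icc (x (0 : Fin (n.dim + 1))) (y (0 : Fin (n.dim + 1))))
        (b : Fin n.dim → I) (hb : b ∈ Set.Icc x' y') : ((γ.toFun b, a) : X × I) ∈ V :=
      hV (consPoint a b) ⟨by rw [← hx]; exact consPoint_mono ha.1 hb.1,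
        by rw [← hy]; exact consPoint_mono ha.2 hb.2⟩
    let V₁ : Opens X := V.comap ⟨fun p => ((p, x (0 : Fin (n.dim + 1))) : X × I), by fun_prop⟩
    let V₂ : Opens I := V.comap ⟨fun t => ((γ.toFun y', t) : X × I), by fun_prop⟩
    have e₁ : X.circ.rel V₁ (γ.toFun x') (γ.toFun y') :=
      γ.map_rel V₁ x' y' hh fun z hz => key _ ⟨le_rfl, h0⟩ z hz
    have e₂ : intervalCirc.rel V₂ (x (0 : Fin (n.dim + 1))) (y (0 : Fin (n.dim + 1))) :=
      intervalCirc_rel_of_le h0 fun z hz => key z hz _ ⟨hh, le_rfl⟩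
    exact (prodCirc_slice_left X.circ intervalCirc (W := V) (fun _ ha => ha) e₁).trans
      (prodCirc_slice_right X.circ intervalCirc (W := V) (fun _ ha => ha) e₂)

/-- The prism `sing X ⟶ (sing (X × I)) ^ □[1]`. -/
def singPrism : sing.{u} ⟶ Strm.cylinder.cyl ⋙ sing ⋙ cubicalPath.path where
  app X :=
    { app := fun n => TypeCat.ofHom fun γ : SingCube X n.unop => γ.prism
      naturality := fun m n f => by
        ext γ
        refine SingCube.ext (ContinuousMap.ext fun (z : Fin (n.unop.dim + 1) → I) => ?_)
        have := eval_shift_consPoint f.unop (z 0) (fun j => z j.succ)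
        rw [consPoint_eta] at this
        have e : ∀ j, Box.eval (Box.shift.map f.unop) I z (Fin.succ j) =
            Box.eval f.unop I (fun j => z j.succ) j := fun j => congrFun this j.succ
        exact congrArg (fun y => ((γ.toFun y, z 0) : X × I)) (funext e).symm }
  naturality X Y f := rfl

lemma sing_homotopic (G : Type u) [SmallCategory G] {X Y : G ⥤ Strm.{u}} (f g : X ⟶ Y)
    (h : (Strm.cylinder.diagram G).Homotopic f g) :
    (cubicalPath.diagram G).Homotopic (((Functor.whiskeringRight G _ _).obj sing).map f)
      (((Functor.whiskeringRight G _ _).obj sing).map g) :=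
  PathObject.homotopic_map_of_cylinder Strm.cylinder cubicalPath sing singPrism
    (fun _ => rfl) (fun _ => rfl) G f g h

/-- The unit `C ⟶ sing |C|`. -/
def singUnit : 𝟭 CubicalSet.{u} ⟶ directedRealization ⋙ sing where
  app C :=
    { app := fun n => TypeCat.ofHom fun c : C.obj n =>
        ({ toFun := C.charMap ⟨n.unop, c⟩
           map_rel := fun V x y h hV => ⟨hV x ⟨le_rfl, h⟩,
            .single ⟨⟨n.unop, c⟩, x, y, cubeCirc_rel_of_le h hV, rfl, rfl⟩⟩ } :
          SingCube (directedRealizationObj C) n.unop)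
      naturality := fun m n f => by
        ext c
        refine SingCube.ext (ContinuousMap.ext fun s => ?_)
        exact Quot.sound (CubicalSet.Glue.mk f.unop c s) }
  naturality X Y f := rfl

/-! ### Realizations of cubical homotopies -/

/-- The map `|B ^ □[1]| × I → |B|` on points. -/
def realizationPathFun (B : CubicalSet.{u}) :
    (cubicalPath.path.obj B).Realization × I → B.Realization :=
  fun p => Quot.lift
    (fun q : (cubicalPath.path.obj B).PreRealization =>
      (Quot.mk _ ⟨⟨Box.shift.obj q.1.1, q.1.2⟩, consPoint p.2 q.2⟩ : B.Realization))
    (by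
      rintro _ _ ⟨φ, c, s⟩
      have := CubicalSet.Glue.mk (C := B) (Box.shift.map φ) c (consPoint p.2 s)
      rw [eval_shift_consPoint] at this
      exact Quot.sound this) p.1

/-- Because `I` is locally compact, continuity on the product can be tested before passing to the
quotient, and there cube by cube. -/
lemma continuous_realizationPathFun (B : CubicalSet.{u}) : Continuous (realizationPathFun B) := by
  refine Topology.IsQuotientMap.continuous_lift_prod_left
    (f := (Quot.mk _ : (cubicalPath.path.obj B).PreRealization → _)) isQuotientMap_quot_mk ?_
  let e := Homeomorph.sigmaProdDistrib (X := fun x : (cubicalPath.path.obj B).Cell =>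
    (Fin x.1.dim → I)) (Y := I)
  rw [← e.symm.comp_continuous_iff']
  refine continuous_sigma fun x => ?_
  exact (B.charMap ⟨Box.shift.obj x.1, x.2⟩).continuous.comp
    (continuous_consPoint.comp continuous_swap)

/-- The map `|B ^ □[1]| × I → |B|`. -/
def realizationPathHom (B : CubicalSet.{u}) :
    (directedRealizationObj (cubicalPath.path.obj B)).cylObj ⟶ directedRealizationObj B where
  toFun := ⟨realizationPathFun B, continuous_realizationPathFun B⟩
  map_rel V p q h := by
    obtain ⟨hp, h⟩ := h
    refine ⟨hp, ?_⟩
    -- A relation inside an open box splits into a move in `|B ^ □[1]|` at a fixed time, followed by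
    -- a move in time at a fixed point. Each is carried by cubes of `B` of one dimension more.
    have key (p q) (h : boxRel (directedRealizationObj (cubicalPath.path.obj B)).circ intervalCirc
        (V.comap ⟨realizationPathFun B, continuous_realizationPathFun B⟩) p q) :
        (directedRealizationObj B).circ.rel V (realizationPathFun B p)
          (realizationPathFun B q) := by
      obtain ⟨U, T, hs, h₁, h₂⟩ := h
      have e₁ : (directedRealizationObj B).circ.rel V (realizationPathFun B p)
          (realizationPathFun B (q.1, p.2)) := by
        refine ⟨hs (Set.mk_mem_prod h₁.1 h₂.1),
          h₁.2.lift (fun x => realizationPathFun B (x, p.2)) ?_⟩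
        rintro _ _ ⟨c, a, b, h, rfl, rfl⟩
        refine ⟨⟨Box.shift.obj c.1, c.2⟩, consPoint p.2 a, consPoint p.2 b, ?_, rfl, rfl⟩
        refine ⟨hs (Set.mk_mem_prod h.1 h₂.1), h.2.lift (fun x => consPoint p.2 x) ?_⟩
        rintro x y ⟨hxy, hI⟩
        refine ⟨consPoint_mono le_rfl hxy, ?_⟩
        intro z hz
        obtain ⟨t, ht, y, hy, rfl⟩ := exists_consPoint_of_mem_Icc hz
        obtain rfl : t = p.2 := le_antisymm ht.2 ht.1
        exact hs (Set.mk_mem_prod (hI hy) h₂.1)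
      have e₂ : (directedRealizationObj B).circ.rel V (realizationPathFun B (q.1, p.2))
          (realizationPathFun B q) := by
        have hq := (directedRealizationObj (cubicalPath.path.obj B)).circ.right_mem h₁
        obtain ⟨⟨⟨c, s⟩⟩, t⟩ := q
        obtain ⟨x, r⟩ := p
        have hq' : ∀ y ∈ T, realizationPathFun B (Quot.mk _ ⟨c, s⟩, y) ∈ V :=
          fun y hy => hs (Set.mk_mem_prod hq hy)
        refine ⟨hq' _ h₂.1, .single ⟨⟨Box.shift.obj c.1, c.2⟩, consPoint r s, consPoint t s, ?_,
          rfl, rfl⟩⟩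
        refine ⟨hq' _ h₂.1, h₂.2.lift (fun y => consPoint y s) ?_⟩
        rintro a b ⟨hab, hI⟩
        refine ⟨consPoint_mono hab le_rfl, ?_⟩
        intro z hz
        obtain ⟨t, ht, y, hy, rfl⟩ := exists_consPoint_of_mem_Icc hz
        obtain rfl : y = s := le_antisymm hy.2 hy.1
        exact hq' t (hI ht)
      exact (directedRealizationObj B).circ.trans e₁ e₂
    induction h with
    | refl => exact .refl
    | tail _ h ih => exact ih.trans (key _ _ h).2

/-- The natural stream map `|B ^ □[1]| × I ⟶ |B|`. -/
def realizationPathEval :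
    cubicalPath.path ⋙ directedRealization.{u} ⋙ Strm.cylinder.cyl ⟶ directedRealization where
  app := realizationPathHom
  naturality B C ψ := by
    apply Strm.Hom.ext
    ext ⟨⟨q⟩, t⟩
    rfl

lemma realizationPathEval_end (ε : Bool) (B : CubicalSet.{u})
    (q : (cubicalPath.path.obj B).PreRealization) :
    realizationPathFun B (Quot.mk _ q, if ε then 1 else 0) =
      (Quot.mk _ ⟨⟨q.1.1, B.map ((Box.coface ε).app q.1.1).op q.1.2⟩, q.2⟩ : B.Realization) := by
  have := CubicalSet.Glue.mk (C := B) ((Box.coface ε).app q.1.1) q.1.2 q.2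
  rw [eval_coface_point] at this
  exact (Quot.sound this).symm

lemma directedRealization_homotopic (G : Type u) [SmallCategory G] {X Y : G ⥤ CubicalSet.{u}}
    (f g : X ⟶ Y) (h : (cubicalPath.diagram G).Homotopic f g) :
    (Strm.cylinder.diagram G).Homotopic ((directedRealizationDiagram G).map f)
      ((directedRealizationDiagram G).map g) :=
  Cylinder.homotopic_map_of_pathObject cubicalPath Strm.cylinder directedRealization
    realizationPathEval
    (fun B => by
      apply Strm.Hom.ext
      ext ⟨q⟩
      exact realizationPathEval_end false B q)
    (fun B => by
      apply Strm.Hom.ext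
      ext ⟨q⟩
      exact realizationPathEval_end true B q) G f g h

/-! ### Thresholds in directed cubes -/

/-- The midpoint of the unit interval. -/
noncomputable def half : I := ⟨1 / 2, by norm_num, by norm_num⟩

lemma half_pos : (0 : I) < half := by
  rw [← Subtype.coe_lt_coe]; norm_num [half]

lemma half_lt_one : half < (1 : I) := by
  rw [← Subtype.coe_lt_coe]; norm_num [half]

/-- The vertex whose coordinates tell which coordinates of `x` are at least `η`. -/
noncomputable def threshold (η : I) {n : Box} (x : Fin n.dim → I) : Box.Vert n :=
  fun j => decide (η ≤ x j)

/-- The vertex whose coordinates tell which coordinates of `x` exceed the midpoint. -/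
noncomputable def upperHalf {n : Box} (x : Fin n.dim → I) : Box.Vert n :=
  fun j => decide (half < x j)

/-- The thresholds strictly between `0` and the midpoint. -/
abbrev Level : Type := {η : I // 0 < η ∧ η < half}

section Threshold

variable {m n : Box}

lemma vert_le_iff {u v : Box.Vert n} : u ≤ v ↔ ∀ j, u j = true → v j = true := by
  refine forall_congr' fun j => ?_
  change @LE.le Bool _ (u j) (v j) ↔ _
  generalize u j = a, v j = b
  revert a b
  decide

lemma threshold_apply (η : I) (x : Fin n.dim → I) (j : Fin n.dim) :
    threshold η x j = true ↔ η ≤ x j := decide_eq_true_iff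

lemma upperHalf_apply (x : Fin n.dim → I) (j : Fin n.dim) :
    upperHalf x j = true ↔ half < x j := decide_eq_true_iff

lemma threshold_anti {η η' : I} (h : η ≤ η') (x : Fin n.dim → I) :
    threshold η' x ≤ threshold η x :=
  vert_le_iff.2 fun j hj => by
    rw [threshold_apply] at hj ⊢
    exact h.trans hj

lemma upperHalf_le_threshold (x : Fin n.dim → I) {η : I} (h : η ≤ half) :
    upperHalf x ≤ threshold η x :=
  vert_le_iff.2 fun j hj => by
    rw [upperHalf_apply] at hj
    rw [threshold_apply]
    exact h.trans hj.le

lemma threshold_half_le (η : Level) (x : Fin n.dim → I) : threshold half x ≤ threshold η.1 x :=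
  threshold_anti η.2.2.le x

/-- An output coordinate is an input coordinate or one of the constants `0`, `1`, and `p` respects
these constants. So cuts strictly inside the interval are compatible with the gluing. -/
lemma eval_cut (φ : m ⟶ n) (p : I → Bool) (h₀ : p 0 = false) (h₁ : p 1 = true)
    (s : Fin m.dim → I) :
    Box.eval φ Bool (fun i => p (s i)) = fun j => p (Box.eval φ I s j) := by
  funext j
  unfold Box.eval
  rcases φ.coord j with i | b
  · rfl
  · cases b
    · exact h₀.symm
    · exact h₁.symm

lemma eval_threshold (φ : m ⟶ n) {η : I} (hη : 0 < η) (s : Fin m.dim → I) :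
    Box.eval φ Bool (threshold η s) = threshold η (Box.eval φ I s) :=
  eval_cut φ (fun t => decide (η ≤ t)) (decide_eq_false hη.not_ge)
    (decide_eq_true unitInterval.le_one') s

lemma eval_upperHalf (φ : m ⟶ n) (s : Fin m.dim → I) :
    Box.eval φ Bool (upperHalf s) = upperHalf (Box.eval φ I s) :=
  eval_cut φ (fun t => decide (half < t)) (decide_eq_false half_pos.not_gt)
    (decide_eq_true half_lt_one) s

end Threshold

/-! ### Cubes that ignore coordinates near a threshold. -/

section Independence

variable {A : Type*} [Category A] {m n : Box}

/-- A functor on `[1]ⁿ` sends `u ≤ v` to an identity. -/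
def ConstOn (c : Box.Vert n ⥤ A) {u v : Box.Vert n} (h : u ≤ v) : Prop :=
  cubeArrow c h = Arrow.mk (𝟙 (c.obj u))

lemma ConstOn.of_eq (c : Box.Vert n ⥤ A) {u v : Box.Vert n} (h : u ≤ v) (e : u = v) :
    ConstOn c h := cubeArrow_self c h e

lemma ConstOn.obj_eq {c : Box.Vert n ⥤ A} {u v : Box.Vert n} {h : u ≤ v} (hc : ConstOn c h) :
    c.obj v = c.obj u := congrArg Comma.right hc

lemma cubeArrow_trans_of_const {c : Box.Vert n ⥤ A} {u v w : Box.Vert n} (h : u ≤ v) {h' : v ≤ w}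
    (hc : ConstOn c h') : cubeArrow c (h.trans h') = cubeArrow c h := by
  have e : homOfLE (h.trans h') = homOfLE h ≫ homOfLE h' := rfl
  have := arrow_mk_comp_congr (f := c.map (homOfLE h)) rfl hc
  rw [← c.map_comp, ← e, Category.comp_id] at this
  exact this

lemma cubeArrow_trans_of_const_left {c : Box.Vert n ⥤ A} {u v w : Box.Vert n} {h : u ≤ v}
    (hc : ConstOn c h) (h' : v ≤ w) : cubeArrow c (h.trans h') = cubeArrow c h' := by
  have e : homOfLE (h.trans h') = homOfLE h ≫ homOfLE h' := rfl
  have hc' : Arrow.mk (c.map (homOfLE h)) = Arrow.mk (𝟙 (c.obj v)) :=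
    hc.trans (congrArg (fun a => Arrow.mk (𝟙 a)) hc.obj_eq.symm)
  have := arrow_mk_comp_congr (g := c.map (homOfLE h')) hc' rfl
  rw [← c.map_comp, ← e, Category.id_comp] at this
  exact this

lemma ConstOn.trans {c : Box.Vert n ⥤ A} {u v w : Box.Vert n} {h : u ≤ v} {h' : v ≤ w}
    (hc : ConstOn c h) (hc' : ConstOn c h') : ConstOn c (h.trans h') :=
  (cubeArrow_trans_of_const h hc').trans hc

lemma ConstOn.cancel {c : Box.Vert n ⥤ A} {u v w : Box.Vert n} {h : u ≤ v} {h' : v ≤ w}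
    (hc : ConstOn c h) (hc' : ConstOn c (h.trans h')) : ConstOn c h' :=
  ((cubeArrow_trans_of_const_left hc h').symm.trans hc').trans
    (congrArg (fun a => Arrow.mk (𝟙 a)) hc.obj_eq.symm)

lemma constOn_evalFunctor (φ : m ⟶ n) (c : Box.Vert n ⥤ A) {u v : Box.Vert m} (h : u ≤ v)
    {u' v' : Box.Vert n} (h' : u' ≤ v') (hu : Box.eval φ Bool u = u')
    (hv : Box.eval φ Bool v = v') : ConstOn (Box.evalFunctor φ ⋙ c) h ↔ ConstOn c h' := by
  subst hu hv
  rfl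

/-- Between the vertices `upperHalf x` and `threshold η x`, the cube `c` does not depend on the
coordinates in which `x` lies in `S`. -/
def Indep (S : Set I) (η : Level) (c : Box.Vert n ⥤ A) (x : Fin n.dim → I) : Prop :=
  ∀ (u v : Box.Vert n) (h : u ≤ v), upperHalf x ≤ u → v ≤ threshold η.1 x →
    (∀ j, u j ≠ v j → x j ∈ S) → ConstOn c h

lemma Indep.mono {S T : Set I} (h : S ⊆ T) {η : Level} {c : Box.Vert n ⥤ A} {x : Fin n.dim → I}
    (hc : Indep T η c x) : Indep S η c x :=
  fun u v huv hu hv hS => hc u v huv hu hv fun j hj => h (hS j hj)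

/-- This makes independence a property of points of `|ner A|`. The plain condition that no
coordinate of the point lies in `S` would not descend: a codegeneracy adds coordinates of arbitrary
value, on which the cube does not depend. -/
lemma indep_evalFunctor (φ : m ⟶ n) (S : Set I) (η : Level)
    (c : Box.Vert n ⥤ A) (s : Fin m.dim → I) :
    Indep S η (Box.evalFunctor φ ⋙ c) s ↔ Indep S η c (Box.eval φ I s) := by
  constructor
  · intro hc u v h hu hv hS
    rw [← eval_upperHalf] at hu
    rw [← eval_threshold φ η.2.1] at hv
    obtain ⟨v', hv', ev, dv⟩ := exists_eval_of_mem_Icc φ (P := Bool)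
      (upperHalf_le_threshold s η.2.2.le) (z := v) ⟨hu.trans h, hv⟩
    -- The lift of `u` is chosen below that of `v`. On unused coordinates both equal `upperHalf s`,
    -- so the lifts differ only where `u` and `v` do.
    obtain ⟨u', hu', eu, du⟩ := exists_eval_of_mem_Icc φ (P := Bool) hv'.1 (z := u)
      ⟨hu, by rw [ev]; exact h⟩
    refine (constOn_evalFunctor φ c (u := u') (v := v') hu'.2 h eu ev).1
      (hc u' v' hu'.2 hu'.1 hv'.2 ?_)
    intro i hi
    by_cases hex : ∃ j, φ.coord j = Sum.inl i
    · obtain ⟨j, hj⟩ := hex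
      have e₁ (w : Fin m.dim → Bool) : Box.eval φ Bool w j = w i := by simp [Box.eval, hj]
      have e₂ : Box.eval φ I s j = s i := by simp [Box.eval, hj]
      rw [← e₂]
      apply hS
      rwa [← ev, ← eu, e₁, e₁]
    · push Not at hex
      exact absurd ((du i hex).trans (dv i hex).symm) hi
  · intro hc u v h hu hv hS
    refine (constOn_evalFunctor φ c h (Box.eval_mono Bool φ h) rfl rfl).2 (hc _ _ _ ?_ ?_ ?_)
    · rw [← eval_upperHalf]
      exact Box.eval_mono Bool φ hu
    · rw [← eval_threshold φ η.2.1]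
      exact Box.eval_mono Bool φ hv
    · intro j hj
      unfold Box.eval at hj ⊢
      rcases hj' : φ.coord j with i | b
      · rw [hj'] at hj
        exact hS i hj
      · rw [hj'] at hj
        exact absurd rfl hj

/-- `x'` is so close to `x` that no coordinate has crossed one of the thresholds `η` and `half`. -/
def Near (η : Level) (x x' : Fin n.dim → I) : Prop :=
  ∀ j, (x j < η.1 → x' j < η.1) ∧ (η.1 < x j → η.1 < x' j) ∧ (x j < half → x' j < half) ∧
    (half < x j → half < x' j)

/-- Finitely many strict inequalities persist nearby; coordinates equal to a threshold may move
either way. -/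
lemma eventually_near (η : Level) (x : Fin n.dim → I) : ∀ᶠ x' in 𝓝 x, Near η x x' := by
  refine eventually_all.2 fun j => ?_
  have hc : ContinuousAt (fun y : Fin n.dim → I => y j) x := (continuous_apply j).continuousAt
  have lt (a : I) : ∀ᶠ x' in 𝓝 x, x j < a → x' j < a := by
    by_cases h : x j < a
    · filter_upwards [hc.eventually_lt_const h] with y hy _ using hy
    · exact Eventually.of_forall fun _ h' => absurd h' h
  have gt (a : I) : ∀ᶠ x' in 𝓝 x, a < x j → a < x' j := by
    by_cases h : a < x j
    · filter_upwards [hc.eventually_const_lt h] with y hy _ using hy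
    · exact Eventually.of_forall fun _ h' => absurd h' h
  filter_upwards [lt η.1, gt η.1, lt half, gt half] with y h₁ h₂ h₃ h₄ using ⟨h₁, h₂, h₃, h₄⟩

lemma Near.threshold_le {η : Level} {x x' : Fin n.dim → I} (h : Near η x x') :
    threshold η.1 x' ≤ threshold η.1 x :=
  vert_le_iff.2 fun j hj => by
    rw [threshold_apply] at hj ⊢
    exact not_lt.1 fun hlt => hj.not_gt ((h j).1 hlt)

lemma Near.threshold_half_le {η : Level} {x x' : Fin n.dim → I} (h : Near η x x') :
    threshold half x' ≤ threshold half x :=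
  vert_le_iff.2 fun j hj => by
    rw [threshold_apply] at hj ⊢
    exact not_lt.1 fun hlt => hj.not_gt ((h j).2.2.1 hlt)

lemma Near.upperHalf_le {η : Level} {x x' : Fin n.dim → I} (h : Near η x x') :
    upperHalf x ≤ upperHalf x' :=
  vert_le_iff.2 fun j hj => by
    rw [upperHalf_apply] at hj ⊢
    exact (h j).2.2.2 hj

lemma Near.eq_of_eq {η : Level} {x x' : Fin n.dim → I} (h : Near η x x') {j : Fin n.dim}
    (hj : x' j = η.1) : x j = η.1 := by
  rcases lt_trichotomy (x j) η.1 with h' | h' | h'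
  · exact absurd hj ((h j).1 h').ne
  · exact h'
  · exact absurd hj ((h j).2.1 h').ne'

lemma Indep.of_near {η : Level} {c : Box.Vert n ⥤ A} {x x' : Fin n.dim → I}
    (hc : Indep {η.1} η c x) (h : Near η x x') : Indep {η.1} η c x' :=
  fun u v huv hu hv hS => hc u v huv (h.upperHalf_le.trans hu) (hv.trans h.threshold_le)
    fun j hj => h.eq_of_eq (hS j hj)

/-- A coordinate that counts for `threshold η x` but not for `threshold η x'` is exactly `η` at `x`.
-/
lemma Indep.constOn_of_near {η : Level} {c : Box.Vert n ⥤ A} {x x' : Fin n.dim → I}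
    (hc : Indep {η.1} η c x) (h : Near η x x') : ConstOn c h.threshold_le := by
  refine hc _ _ _ (h.upperHalf_le.trans (upperHalf_le_threshold x' η.2.2.le)) le_rfl ?_
  intro j hj
  have h₁ : threshold η.1 x j = true := by
    have := vert_le_iff.1 h.threshold_le j
    revert hj this
    generalize threshold η.1 x' j = a, threshold η.1 x j = b
    revert a b
    decide
  have h₂ : ¬ threshold η.1 x' j = true := fun h' => hj (h'.trans h₁.symm)
  rw [threshold_apply] at h₁ h₂
  refine (le_antisymm h₁ (not_lt.1 fun hlt => h₂ ?_)).symm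
  exact ((h j).2.1 hlt).le

/-- Independence of the coordinates in `[η, 1/2)` propagates upwards as long as there is
independence of the coordinates equal to `η`. -/
lemma Indep.of_le {η : Level} {c : Box.Vert n ⥤ A} {x x' : Fin n.dim → I} (hxx' : x ≤ x')
    (hI : ∀ z ∈ Set.Icc x x', Indep {η.1} η c z) (hc : Indep (Set.Ico η.1 half) η c x) :
    Indep (Set.Ico η.1 half) η c x' := by
  classical
  -- At `z` the coordinates that cross `η` on the way to `x'` are stopped exactly at `η`, so
  -- independence at `z` applies to every coordinate gained.
  let z : Fin n.dim → I := fun j => if x j < η.1 ∧ η.1 ≤ x' j then η.1 else x j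
  have hz : z ∈ Set.Icc x x' := by
    refine ⟨fun j => ?_, fun j => ?_⟩ <;> dsimp only [z] <;> split_ifs with h
    · exact h.1.le
    · exact le_rfl
    · exact h.2
    · exact hxx' j
  have hzx : upperHalf z ≤ upperHalf x := vert_le_iff.2 fun j hj => by
    rw [upperHalf_apply] at hj ⊢
    dsimp only [z] at hj
    split_ifs at hj with h
    · exact absurd hj η.2.2.le.not_gt
    · exact hj
  have hxx : upperHalf x ≤ upperHalf x' := vert_le_iff.2 fun j hj => by
    rw [upperHalf_apply] at hj ⊢
    exact hj.trans_le (hxx' j)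
  have hx'z : threshold η.1 x' ≤ threshold η.1 z := vert_le_iff.2 fun j hj => by
    rw [threshold_apply] at hj ⊢
    dsimp only [z]
    split_ifs with h
    · exact le_rfl
    · exact not_lt.1 fun hlt => h ⟨hlt, hj⟩
  intro u v huv hu hv hS
  -- Discarding the gained coordinates does not affect `c`, by independence at `z`; between `cut u`
  -- and `cut v` it is constant by independence at `x`. Comparing the two ways from `cut u` to `v`
  -- settles `u ≤ v`.
  let cut (w : Box.Vert n) : Box.Vert n := fun j => w j && threshold η.1 x j
  have cut_apply (w : Box.Vert n) (j) : cut w j = true ↔ w j = true ∧ η.1 ≤ x j := by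
    simp only [cut, Bool.and_eq_true, threshold_apply]
  have cut_le (w : Box.Vert n) : cut w ≤ w := vert_le_iff.2 fun j hj => ((cut_apply w j).1 hj).1
  have le_cut (w : Box.Vert n) (hw : upperHalf x ≤ w) : upperHalf x ≤ cut w :=
    vert_le_iff.2 fun j hj => (cut_apply w j).2 ⟨vert_le_iff.1 hw j hj,
      η.2.2.le.trans ((upperHalf_apply x j).1 hj).le⟩
  have const_cut (w : Box.Vert n) (hw : upperHalf x ≤ w) (hw' : w ≤ threshold η.1 x') :
      ConstOn c (cut_le w) := by
    refine hI z hz _ _ _ (hzx.trans (le_cut w hw)) (hw'.trans hx'z) fun j hj => ?_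
    have hwj : w j = true := by
      by_contra h
      have h' : ¬ cut w j = true := fun h' => h (vert_le_iff.1 (cut_le w) j h')
      simp only [Bool.not_eq_true] at h h'
      exact hj (h'.trans h.symm)
    have hxj : x j < η.1 := not_le.1 fun h => hj (((cut_apply w j).2 ⟨hwj, h⟩).trans hwj.symm)
    have hx'j := (threshold_apply _ _ _).1 (vert_le_iff.1 hw' j hwj)
    dsimp only [z]
    rw [if_pos ⟨hxj, hx'j⟩]
    rfl
  have hcut : cut u ≤ cut v := vert_le_iff.2 fun j hj => by
    rw [cut_apply] at hj ⊢
    exact ⟨vert_le_iff.1 huv j hj.1, hj.2⟩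
  have hc' : ConstOn c hcut := by
    refine hc _ _ _ (le_cut u (hxx.trans hu)) (vert_le_iff.2 fun j hj =>
      (threshold_apply _ _ _).2 ((cut_apply v j).1 hj).2) fun j hj => ?_
    have hxj : η.1 ≤ x j := by
      by_contra h
      have h' (w : Box.Vert n) : cut w j = false := by
        rw [← Bool.not_eq_true, cut_apply]; exact fun h' => h h'.2
      exact hj ((h' u).trans (h' v).symm)
    have hne : u j ≠ v j := fun h => hj (by simp only [cut, h])
    exact ⟨hxj, (hxx' j).trans_lt (hS j hne).2⟩
  have h₁ := const_cut u (hxx.trans hu) (huv.trans hv)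
  have h₂ := const_cut v ((hxx.trans hu).trans huv) hv
  exact h₁.cancel (hc'.trans h₂)

lemma Indep.constOn_threshold {η : Level} {c : Box.Vert n ⥤ A} {x : Fin n.dim → I}
    (hc : Indep (Set.Ico η.1 half) η c x) : ConstOn c (threshold_half_le η x) := by
  refine hc _ _ _ (upperHalf_le_threshold x le_rfl) le_rfl fun j hj => ?_
  have h := threshold_apply half x j
  have h' := threshold_apply η.1 x j
  have hle := vert_le_iff.1 (threshold_half_le η x) j
  by_cases h₁ : threshold half x j = true
  · exact absurd (h₁.trans (hle h₁).symm) hj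
  · have h₂ : threshold η.1 x j = true := by
      by_contra h₂
      simp only [Bool.not_eq_true] at h₁ h₂
      exact hj (h₁.trans h₂.symm)
    exact ⟨h'.1 h₂, not_le.1 fun h₃ => h₁ (h.2 h₃)⟩

lemma exists_level (x : Fin n.dim → I) : ∃ η : Level, ∀ j, x j < half → x j < η.1 := by
  have h : ∀ᶠ η in 𝓝[<] half, ∀ j, x j < half → x j < η := by
    refine eventually_all.2 fun j => ?_
    by_cases h : x j < half
    · filter_upwards [mem_nhdsWithin_of_mem_nhds (Ioi_mem_nhds h)] with η hη _ using hη
    · exact Eventually.of_forall fun _ h' => absurd h' h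
  have h' : ∀ᶠ η in 𝓝[<] half, 0 < η ∧ η < half :=
    Eventually.and (mem_nhdsWithin_of_mem_nhds (Ioi_mem_nhds half_pos)) self_mem_nhdsWithin
  have : (𝓝[<] half).NeBot := nhdsLT_neBot_of_exists_lt ⟨0, half_pos⟩
  obtain ⟨η, h₁, h₂⟩ := (h.and h').exists
  exact ⟨⟨η, h₂⟩, h₁⟩

/-- If `η` exceeds all coordinates below the midpoint, then no coordinate lies in `[η, 1/2)` and the
condition is vacuous. -/
lemma exists_indep (c : Box.Vert n ⥤ A) (x : Fin n.dim → I) :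
    ∃ η : Level, Indep (Set.Ico η.1 half) η c x := by
  obtain ⟨η, hη⟩ := exists_level x
  refine ⟨η, fun u v huv hu hv hS => ConstOn.of_eq c huv (funext fun j => ?_)⟩
  by_contra h
  have := hS j h
  exact (hη j this.2).not_ge this.1

end Independence

/-! ### Continuation of local data over directed cubes -/

/-- Data that can be continued locally over the directed cube `Iⁿ`, uniquely in upward
directions: `fiber t` is the set of values at `t`, and `cont t s y y'` says that the value `y` at
`t` continues to the value `y'` at the point `s` near `t`. -/
structure LocalContinuation (n : ℕ) (Y : Type*) where
  fiber : (Fin n → I) → Set Y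
  dom : (Fin n → I) → Set (Fin n → I)
  cont : (Fin n → I) → (Fin n → I) → Y → Y → Prop
  isOpen_dom : ∀ t, IsOpen (dom t)
  mem_dom : ∀ t, t ∈ dom t
  functional : ∀ {t s y y' y''}, cont t s y y' → cont t s y y'' → y' = y''
  exists_cont : ∀ {t s y}, s ∈ dom t → y ∈ fiber t → ∃ y' ∈ fiber s, cont t s y y'
  coherent : ∀ {t s y z}, s ∈ dom t → y ∈ fiber t → cont t s y z →
    ∀ᶠ r in 𝓝 s, ∀ y', cont t r y y' ↔ cont s r z y'
  fiber_eq : ∀ {t s}, t ≤ s → Set.Icc t s ⊆ dom t → fiber s = fiber t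
  cont_self : ∀ {t s y}, t ≤ s → Set.Icc t s ⊆ dom t → y ∈ fiber t → cont t s y y

namespace LocalContinuation

variable {n : ℕ} {Y : Type*} (K : LocalContinuation n Y)

/-- A family of values over `R` that is locally given by continuation. -/
def Section (R : Set (Fin n → I)) (ρ : (Fin n → I) → Y) : Prop :=
  ∀ t ∈ R, ρ t ∈ K.fiber t ∧ ∀ᶠ s in 𝓝[R] t, K.cont t s (ρ t) (ρ s)

variable {K}

lemma Section.mono {R R' : Set (Fin n → I)} {ρ : (Fin n → I) → Y} (h : K.Section R ρ)
    (hR : R' ⊆ R) : K.Section R' ρ :=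
  fun t ht => ⟨(h t (hR ht)).1, (h t (hR ht)).2.filter_mono (nhdsWithin_mono t hR)⟩

lemma Section.congr {R : Set (Fin n → I)} {ρ ρ' : (Fin n → I) → Y} (h : K.Section R ρ)
    (hρ : ∀ t ∈ R, ρ' t = ρ t) : K.Section R ρ' := by
  intro t ht
  rw [hρ t ht]
  refine ⟨(h t ht).1, ?_⟩
  filter_upwards [(h t ht).2, self_mem_nhdsWithin] with s hs hsR
  rwa [hρ s hsR]

/-- A point off a closed set has no points of that set nearby, so the local condition may be checked
on each set separately. -/
lemma Section.union {R R' : Set (Fin n → I)} {ρ : (Fin n → I) → Y} (hR : IsClosed R)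
    (hR' : IsClosed R') (h : K.Section R ρ) (h' : K.Section R' ρ) : K.Section (R ∪ R') ρ := by
  have key : ∀ {T : Set (Fin n → I)}, IsClosed T → K.Section T ρ → ∀ t,
      ∀ᶠ s in 𝓝[T] t, K.cont t s (ρ t) (ρ s) := by
    intro T hT hρ t
    by_cases ht : t ∈ T
    · exact (hρ t ht).2
    · have : 𝓝[T] t = ⊥ := by
        rw [← notMem_closure_iff_nhdsWithin_eq_bot, hT.closure_eq]
        exact ht
      rw [this]
      exact eventually_bot
  intro t ht
  refine ⟨ht.elim (fun ht => (h t ht).1) (fun ht => (h' t ht).1), ?_⟩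
  rw [nhdsWithin_union, eventually_sup]
  exact ⟨key hR h t, key hR' h' t⟩

lemma eventually_Icc_subset {O : Set (Fin n → I)} (hO : IsOpen O) {t : Fin n → I} (ht : t ∈ O) :
    ∀ᶠ s in 𝓝 t, Set.Icc t s ⊆ O := by
  obtain ⟨ε, hε, hb⟩ := Metric.isOpen_iff.1 hO t ht
  filter_upwards [Metric.ball_mem_nhds t hε] with s hs z hz
  refine hb (Metric.mem_ball.2 (lt_of_le_of_lt ?_ (Metric.mem_ball.1 hs)))
  exact (dist_pi_le_iff dist_nonneg).2 fun i =>
    (interval_dist _ _ _ (hz.1 i) (hz.2 i)).trans (dist_le_pi_dist s t i)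

/-- A section is locally constant in upward directions. -/
lemma Section.eventually_eq {R : Set (Fin n → I)} {ρ : (Fin n → I) → Y} (h : K.Section R ρ)
    {t : Fin n → I} (ht : t ∈ R) : ∀ᶠ s in 𝓝[R] t, t ≤ s → ρ s = ρ t := by
  filter_upwards [(h t ht).2, mem_nhdsWithin_of_mem_nhds
    (eventually_Icc_subset (K.isOpen_dom t) (K.mem_dom t))] with s hs hs' hts
  exact K.functional hs (K.cont_self hts hs' (h t ht).1)

/-- A monotone path from `t` to `b`. -/
noncomputable def pathTo (t b : Fin n → I) (τ : I) : Fin n → I := fun j => max (t j) (min (b j) τ)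

lemma continuous_pathTo (t b : Fin n → I) : Continuous (pathTo t b) := by
  unfold pathTo
  fun_prop

lemma pathTo_mono (t b : Fin n → I) : Monotone (pathTo t b) :=
  fun _ _ h _ => max_le_max le_rfl (min_le_min le_rfl h)

lemma pathTo_zero (t b : Fin n → I) : pathTo t b 0 = t := by
  funext j
  unfold pathTo
  rw [min_eq_right unitInterval.nonneg', max_eq_left unitInterval.nonneg']

lemma pathTo_one {t b : Fin n → I} (h : t ≤ b) : pathTo t b 1 = b := by
  funext j
  unfold pathTo
  rw [min_eq_left unitInterval.le_one', max_eq_right (h j)]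

/-- Sections over an order interval are determined by their value at the top. -/
lemma Section.eq_of_eq_top {a b : Fin n → I} {ρ ρ' : (Fin n → I) → Y}
    (h : K.Section (Set.Icc a b) ρ) (h' : K.Section (Set.Icc a b) ρ') (e : ρ b = ρ' b) :
    ∀ t ∈ Set.Icc a b, ρ t = ρ' t := by
  intro t ht
  by_contra hne
  let ℓ := pathTo t b
  have hℓ (τ : I) : ℓ τ ∈ Set.Icc a b := by
    refine ⟨ht.1.trans ?_, ?_⟩
    · rw [← pathTo_zero t b]; exact pathTo_mono t b unitInterval.nonneg'
    · rw [← pathTo_one ht.2]; exact pathTo_mono t b unitInterval.le_one'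
  have hlim (τ : I) : Tendsto ℓ (𝓝 τ) (𝓝[Set.Icc a b] (ℓ τ)) :=
    tendsto_nhdsWithin_iff.2 ⟨(continuous_pathTo t b).continuousAt, Eventually.of_forall hℓ⟩
  let B : Set I := {τ | ρ (ℓ τ) ≠ ρ' (ℓ τ)}
  -- Where the sections agree, both are given nearby by continuation of the same value; so agreement
  -- is open.
  have hB : IsClosed B := by
    rw [← isOpen_compl_iff, isOpen_iff_mem_nhds]
    intro τ hτ
    have hτ' : ρ (ℓ τ) = ρ' (ℓ τ) := not_not.1 hτ
    filter_upwards [(hlim τ).eventually (h _ (hℓ τ)).2, (hlim τ).eventually (h' _ (hℓ τ)).2]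
      with s hs hs'
    rw [← hτ'] at hs'
    exact not_not.2 (K.functional hs hs')
  have hne' : B.Nonempty := ⟨0, by change ρ (pathTo t b 0) ≠ ρ' (pathTo t b 0); rwa [pathTo_zero]⟩
  -- Just above the last point of disagreement both sections are constant, so the disagreement would
  -- persist beyond it.
  obtain ⟨τ, hτ, hmax⟩ := hB.isCompact.exists_isGreatest hne'
  have hτ1 : τ < 1 := by
    refine lt_of_le_of_ne unitInterval.le_one' ?_
    rintro rfl
    apply hτ
    change ρ (pathTo t b 1) = ρ' (pathTo t b 1)
    rwa [pathTo_one ht.2]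
  have : (𝓝[>] τ).NeBot := nhdsGT_neBot_of_exists_gt ⟨1, hτ1⟩
  obtain ⟨s, ⟨hs, hs'⟩, hlt⟩ := ((((hlim τ).eventually (h.eventually_eq (hℓ τ))).and
    ((hlim τ).eventually (h'.eventually_eq (hℓ τ)))).filter_mono nhdsWithin_le_nhds
      |>.and (self_mem_nhdsWithin : ∀ᶠ s in 𝓝[>] τ, s ∈ Set.Ioi τ)).exists
  have hle : ℓ τ ≤ ℓ s := pathTo_mono t b (le_of_lt hlt)
  refine absurd (hmax (a := s) ?_) (not_le.2 hlt)
  change ρ (ℓ s) ≠ ρ' (ℓ s)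
  rw [hs hle, hs' hle]
  exact hτ

variable (K) in
/-- Every value at the top of the order interval extends to a section. -/
def Extends (a b : Fin n → I) : Prop :=
  ∀ f ∈ K.fiber b, ∃ ρ, K.Section (Set.Icc a b) ρ ∧ ρ b = f

/-- The fibres at `t` and at the top `b` coincide by upward constancy. So a value at `b` is a value
at `t`, whose continuation from `t` is a section by coherence. -/
lemma extends_of_subset_dom {a b t : Fin n → I} (hat : a ≤ t) (htb : t ≤ b)
    (h : Set.Icc a b ⊆ K.dom t) : K.Extends a b := by
  classical
  intro f hf
  have htb' : Set.Icc t b ⊆ K.dom t := (Set.Icc_subset_Icc_left hat).trans h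
  rw [K.fiber_eq htb htb'] at hf
  have : Nonempty Y := ⟨f⟩
  have hex : ∀ s ∈ K.dom t, ∃ y ∈ K.fiber s, K.cont t s f y := fun s hs => K.exists_cont hs hf
  choose! ρ hρ hρ' using hex
  refine ⟨ρ, fun s hs => ⟨hρ s (h hs), ?_⟩, ?_⟩
  · filter_upwards [mem_nhdsWithin_of_mem_nhds (K.coherent (h hs) hf (hρ' s (h hs))),
      self_mem_nhdsWithin] with r hr hrR
    exact (hr _).1 (hρ' r (h hrR))
  · exact K.functional (hρ' b (h ⟨hat.trans htb, le_rfl⟩)) (K.cont_self htb htb' hf)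

/-- The upper half is treated first, and its value at the top of the lower half is then extended
downwards. The top of the common face is that same point, so uniqueness from the top makes the two
sections agree on the face. -/
lemma extends_of_split {a b : Fin n → I} (hab : a ≤ b) (i : Fin n) (m : I) (hm : a i ≤ m)
    (hm' : m ≤ b i) (h₁ : K.Extends a (Function.update b i m))
    (h₂ : K.Extends (Function.update a i m) b) : K.Extends a b := by
  classical
  intro f hf
  obtain ⟨ρ₂, hρ₂, hf₂⟩ := h₂ f hf
  have hbm : Function.update b i m ≤ b := update_le_self_iff.2 hm'
  have ham : a ≤ Function.update a i m := le_update_self_iff.2 hm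
  have hmm : Function.update a i m ≤ Function.update b i m :=
    update_le_update_iff.2 ⟨le_rfl, fun j _ => hab j⟩
  obtain ⟨ρ₁, hρ₁, hf₁⟩ := h₁ (ρ₂ (Function.update b i m)) (hρ₂ _ ⟨hmm, hbm⟩).1
  have hag := (hρ₁.mono (Set.Icc_subset_Icc_left ham)).eq_of_eq_top
    (hρ₂.mono (Set.Icc_subset_Icc_right hbm)) hf₁
  let ρ : (Fin n → I) → Y := fun t => if m ≤ t i then ρ₂ t else ρ₁ t
  have e₂ (t) (ht : t ∈ Set.Icc (Function.update a i m) b) : ρ t = ρ₂ t := by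
    have := ht.1 i
    rw [Function.update_self] at this
    exact if_pos this
  have e₁ (t) (ht : t ∈ Set.Icc a (Function.update b i m)) : ρ t = ρ₁ t := by
    by_cases h : m ≤ t i
    · rw [show ρ t = ρ₂ t from if_pos h]
      exact (hag t ⟨update_le_iff.2 ⟨h, fun j _ => ht.1 j⟩, ht.2⟩).symm
    · exact if_neg h
  have hU : Set.Icc a b ⊆ Set.Icc a (Function.update b i m) ∪
      Set.Icc (Function.update a i m) b := by
    intro t ht
    rcases le_total (t i) m with h | h
    · exact Or.inl ⟨ht.1, le_update_iff.2 ⟨h, fun j _ => ht.2 j⟩⟩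
    · exact Or.inr ⟨update_le_iff.2 ⟨h, fun j _ => ht.1 j⟩, ht.2⟩
  refine ⟨ρ, ((hρ₁.congr e₁).union isClosed_Icc isClosed_Icc (hρ₂.congr e₂)).mono hU, ?_⟩
  rw [e₂ b ⟨hmm.trans hbm, le_rfl⟩, hf₂]

lemma exists_not_extends_half {a b : Fin n → I} (hab : a ≤ b) (h : ¬ K.Extends a b) :
    ∃ a' b' : Fin n → I, a ≤ a' ∧ a' ≤ b' ∧ b' ≤ b ∧ ¬ K.Extends a' b' ∧
      ∀ j, (b' j : ℝ) - a' j = (b j - a j) / 2 := by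
  classical
  have key : ∀ J : Finset (Fin n), ∃ a' b' : Fin n → I, a ≤ a' ∧ a' ≤ b' ∧ b' ≤ b ∧
      ¬ K.Extends a' b' ∧ (∀ j ∈ J, (b' j : ℝ) - a' j = (b j - a j) / 2) ∧
      ∀ j ∉ J, a' j = a j ∧ b' j = b j := by
    intro J
    induction J using Finset.induction_on with
    | empty => exact ⟨a, b, le_rfl, hab, le_rfl, h, by simp, by simp⟩
    | insert i J hi ih =>
      obtain ⟨a', b', h₁, h₂, h₃, h₄, h₅, h₆⟩ := ih
      obtain ⟨m, hm⟩ : ∃ m : I, (m : ℝ) = ((a i : ℝ) + b i) / 2 :=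
        ⟨⟨((a i : ℝ) + b i) / 2, by linarith [(a i).2.1, (b i).2.1],
          by linarith [(a i).2.2, (b i).2.2]⟩, rfl⟩
      have habi : (a i : ℝ) ≤ b i := hab i
      have ham : a i ≤ m := Subtype.coe_le_coe.1 (by rw [hm]; linarith)
      have hmb : m ≤ b i := Subtype.coe_le_coe.1 (by rw [hm]; linarith)
      have ham' : a' i ≤ m := by rw [(h₆ i hi).1]; exact ham
      have hmb' : m ≤ b' i := by rw [(h₆ i hi).2]; exact hmb
      have hne (j) (hj : j ∈ J) : j ≠ i := fun e => hi (e ▸ hj)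
      by_cases hE : K.Extends a' (Function.update b' i m)
      · refine ⟨Function.update a' i m, b', h₁.trans (le_update_self_iff.2 ham'),
          update_le_iff.2 ⟨hmb', fun j _ => h₂ j⟩, h₃,
          fun hE' => h₄ (extends_of_split h₂ i m ham' hmb' hE hE'), ?_, ?_⟩
        · intro j hj
          rcases Finset.mem_insert.1 hj with rfl | hj
          · rw [Function.update_self, (h₆ j hi).2, hm]; ring
          · rw [Function.update_of_ne (hne j hj)]; exact h₅ j hj
        · intro j hj
          rw [Finset.mem_insert, not_or] at hj
          rw [Function.update_of_ne hj.1]; exact h₆ j hj.2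
      · refine ⟨a', Function.update b' i m, h₁,
          le_update_iff.2 ⟨ham', fun j _ => h₂ j⟩,
          (update_le_self_iff.2 hmb').trans h₃, hE, ?_, ?_⟩
        · intro j hj
          rcases Finset.mem_insert.1 hj with rfl | hj
          · rw [Function.update_self, (h₆ j hi).1, hm]; ring
          · rw [Function.update_of_ne (hne j hj)]; exact h₅ j hj
        · intro j hj
          rw [Finset.mem_insert, not_or] at hj
          rw [Function.update_of_ne hj.1]; exact h₆ j hj.2
  obtain ⟨a', b', h₁, h₂, h₃, h₄, h₅, -⟩ := key Finset.univ
  exact ⟨a', b', h₁, h₂, h₃, h₄, fun j => h₅ j (Finset.mem_univ j)⟩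

variable (K) in
/-- Every value at the top of an order interval extends to a section, by bisection. -/
theorem extends_all {a b : Fin n → I} (hab : a ≤ b) : K.Extends a b := by
  by_contra h
  let Bad := {p : (Fin n → I) × (Fin n → I) // p.1 ≤ p.2 ∧ ¬ K.Extends p.1 p.2}
  have step (p : Bad) : ∃ q : Bad, p.1.1 ≤ q.1.1 ∧ q.1.2 ≤ p.1.2 ∧
      ∀ j, (q.1.2 j : ℝ) - q.1.1 j = (p.1.2 j - p.1.1 j) / 2 := by
    obtain ⟨a', b', h₁, h₂, h₃, h₄, h₅⟩ := exists_not_extends_half p.2.1 p.2.2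
    exact ⟨⟨(a', b'), h₂, h₄⟩, h₁, h₃, h₅⟩
  choose next h₁ h₂ h₃ using step
  let s : ℕ → Bad := fun k => next^[k] ⟨(a, b), hab, h⟩
  have hs (k : ℕ) : s (k + 1) = next (s k) := Function.iterate_succ_apply' next k _
  have hlen (k : ℕ) (j) : ((s k).1.2 j : ℝ) - (s k).1.1 j ≤ (1 / 2) ^ k := by
    induction k with
    | zero =>
      change (b j : ℝ) - a j ≤ 1
      linarith [(b j).2.2, (a j).2.1]
    | succ k ih =>
      rw [hs, h₃, pow_succ]
      linarith
  -- The bad intervals shrink to the point `t`, so one of them lies in `dom t`, where every value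
  -- does extend.
  obtain ⟨t, ht⟩ := IsCompact.nonempty_iInter_of_sequence_nonempty_isCompact_isClosed
    (fun k => Set.Icc (s k).1.1 (s k).1.2)
    (fun k => by
      rw [hs]
      exact Set.Icc_subset_Icc (h₁ _) (h₂ _))
    (fun k => Set.nonempty_Icc.2 (s k).2.1) isCompact_Icc (fun k => isClosed_Icc)
  rw [Set.mem_iInter] at ht
  obtain ⟨ε, hε, hb⟩ := Metric.isOpen_iff.1 (K.isOpen_dom t) t (K.mem_dom t)
  obtain ⟨k, hk⟩ := exists_pow_lt_of_lt_one hε (by norm_num : (1 / 2 : ℝ) < 1)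
  refine (s k).2.2 (extends_of_subset_dom (ht k).1 (ht k).2 fun z hz => hb ?_)
  refine lt_of_le_of_lt ((dist_pi_le_iff (by positivity)).2 fun j => ?_) hk
  rw [Subtype.dist_eq, Real.dist_eq]
  have := hlen k j
  have a₁ : ((s k).1.1 j : ℝ) ≤ z j := hz.1 j
  have a₂ : (z j : ℝ) ≤ (s k).1.2 j := hz.2 j
  have a₃ : ((s k).1.1 j : ℝ) ≤ t j := (ht k).1 j
  have a₄ : (t j : ℝ) ≤ (s k).1.2 j := (ht k).2 j
  exact abs_le.2 ⟨by linarith, by linarith⟩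

end LocalContinuation

/-! ### Precomposition of morphisms with a fixed target -/

section PreRel

variable {A : Type*} [Category A] {a : A}

/-- The value `y'` is obtained from `y` by precomposition with `g`. -/
def PreRel (a : A) (g : Arrow A) (y y' : Σ b : A, (b ⟶ a)) : Prop :=
  ∃ f : g.right ⟶ a, y = ⟨g.right, f⟩ ∧ y' = ⟨g.left, g.hom ≫ f⟩

/-- Precomposition is encoded as a partial function, given by its graph, because the source of `y`
matches `g.right` only propositionally. -/
lemma PreRel.functional {g : Arrow A} {y y' y'' : Σ b : A, (b ⟶ a)} (h : PreRel a g y y')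
    (h' : PreRel a g y y'') : y' = y'' := by
  obtain ⟨f, rfl, rfl⟩ := h
  obtain ⟨f', e, rfl⟩ := h'
  obtain rfl := eq_of_heq (Sigma.mk.inj e).2
  rfl

lemma exists_preRel {g : Arrow A} {y : Σ b : A, (b ⟶ a)} (h : y.1 = g.right) :
    ∃ y' : Σ b : A, (b ⟶ a), y'.1 = g.left ∧ PreRel a g y y' := by
  obtain ⟨b, f⟩ := y
  obtain rfl : b = g.right := h
  exact ⟨_, rfl, f, rfl, rfl⟩

lemma preRel_id {b : A} {y : Σ b : A, (b ⟶ a)} (h : y.1 = b) :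
    PreRel a (Arrow.mk (𝟙 b)) y y := by
  subst h
  exact ⟨y.2, rfl, by simp⟩

lemma preRel_comp {x y z : A} (f : x ⟶ y) (g : y ⟶ z) (s t : Σ b : A, (b ⟶ a)) :
    PreRel a (Arrow.mk (f ≫ g)) s t ↔
      ∃ r, PreRel a (Arrow.mk g) s r ∧ PreRel a (Arrow.mk f) r t := by
  constructor
  · rintro ⟨k, rfl, rfl⟩
    exact ⟨_, ⟨k, rfl, rfl⟩, ⟨g ≫ k, rfl, by simp⟩⟩
  · rintro ⟨r, ⟨k, rfl, rfl⟩, ⟨l, e, rfl⟩⟩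
    obtain rfl : g ≫ k = l := eq_of_heq (Sigma.mk.inj e).2
    exact ⟨k, rfl, by simp⟩

/-- The action of a functor on morphisms with target `a`, followed by a morphism with source
`F.obj a`. -/
def sliceMap {B : Type*} [Category B] (F : A ⥤ B) {b : B} (g : F.obj a ⟶ b)
    (y : Σ b : A, (b ⟶ a)) : Σ b' : B, (b' ⟶ b) :=
  ⟨F.obj y.1, F.map y.2 ≫ g⟩

lemma PreRel.map {B : Type*} [Category B] (F : A ⥤ B) {b : B} (k : F.obj a ⟶ b) {g : Arrow A}
    {y y' : Σ b : A, (b ⟶ a)} (h : PreRel a g y y') :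
    PreRel b (F.mapArrow.obj g) (sliceMap F k y) (sliceMap F k y') := by
  obtain ⟨f, rfl, rfl⟩ := h
  refine ⟨F.map f ≫ k, rfl, Sigma.ext rfl (heq_of_eq ?_)⟩
  change F.map (g.hom ≫ f) ≫ k = F.map g.hom ≫ F.map f ≫ k
  rw [F.map_comp, Category.assoc]

end PreRel

/-! ### The realization of a nerve -/

section Nerve

variable {A B : Cat.{u, u}} {m n : Box}

/-- The point of `|ner A|` with coordinates `x` in the cube `c`. -/
def nerPoint (c : Box.Vert n ⥤ A) (x : Fin n.dim → I) : (ner.obj A).Realization :=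
  Quot.mk _ ⟨⟨n, c⟩, x⟩

lemma exists_nerPoint (p : (ner.obj A).Realization) :
    ∃ (n : Box) (c : Box.Vert n ⥤ A) (x : Fin n.dim → I), p = nerPoint c x := by
  obtain ⟨⟨⟨n, c⟩, x⟩⟩ := p
  exact ⟨n, c, x, rfl⟩

lemma isOpen_realization {E : Set (ner.obj A).Realization}
    (h : ∀ (n : Box) (c : Box.Vert n ⥤ A) (x : Fin n.dim → I), nerPoint c x ∈ E →
      ∀ᶠ x' in 𝓝 x, nerPoint c x' ∈ E) : IsOpen E := by
  refine isQuotientMap_quot_mk.isOpen_preimage.1 (isOpen_sigma_iff.2 ?_)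
  rintro ⟨n, c⟩
  exact isOpen_iff_mem_nhds.2 fun x hx => h n c x hx

/-- The function `|ner A| → A` that rounds the coordinates of a point in a cube. -/
noncomputable def retractObj : (ner.obj A).Realization → A :=
  Quot.lift (fun p => Functor.obj (C := Box.Vert p.1.1) (D := A) p.1.2 (threshold half p.2)) (by
    rintro _ _ ⟨φ, c, s⟩
    exact congrArg (Functor.obj (D := A) c) (eval_threshold φ half_pos s))

/-- The arrow given by lowering the threshold from the midpoint to `η`. -/
noncomputable def stepArrow (η : Level) : (ner.obj A).Realization → Arrow A :=
  Quot.lift (fun p => cubeArrow (A := A) (n := p.1.1) p.1.2 (threshold_half_le η p.2)) (by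
    rintro _ _ ⟨φ, c, s⟩
    exact cubeArrow_evalFunctor (A := A) φ c _ _ (eval_threshold φ half_pos s)
      (eval_threshold φ η.2.1 s))

/-- Independence of coordinates at a point of `|ner A|`. -/
def IndepAt (S : Set I) (η : Level) : (ner.obj A).Realization → Prop :=
  Quot.lift (fun p => Indep (A := A) (n := p.1.1) S η p.1.2 p.2) (by
    rintro _ _ ⟨φ, c, s⟩
    exact propext (indep_evalFunctor (A := A) φ S η c s))

lemma stepArrow_left (η : Level) (p : (ner.obj A).Realization) :
    (stepArrow η p).left = retractObj p := by
  obtain ⟨p⟩ := p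
  rfl

lemma indepAt_nerPoint (S : Set I) (η : Level) (c : Box.Vert n ⥤ A) (x : Fin n.dim → I) :
    IndepAt S η (nerPoint c x) ↔ Indep S η c x := Iff.rfl

lemma stepArrow_nerPoint (η : Level) (c : Box.Vert n ⥤ A) (x : Fin n.dim → I) :
    stepArrow η (nerPoint c x) = cubeArrow c (threshold_half_le η x) := rfl

lemma IndepAt.stepArrow_eq {η : Level} {p : (ner.obj A).Realization}
    (h : IndepAt (Set.Ico η.1 half) η p) : stepArrow η p = Arrow.mk (𝟙 (retractObj p)) := by
  obtain ⟨n, c, x, rfl⟩ := exists_nerPoint p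
  exact Indep.constOn_threshold ((indepAt_nerPoint _ _ _ _).1 h)

lemma exists_indepAt (p : (ner.obj A).Realization) :
    ∃ η : Level, IndepAt (Set.Ico η.1 half) η p := by
  obtain ⟨n, c, x, rfl⟩ := exists_nerPoint p
  exact exists_indep c x

/-- A level adapted to a point of `|ner A|`. -/
noncomputable def level (p : (ner.obj A).Realization) : Level := (exists_indepAt p).choose

lemma indepAt_level (p : (ner.obj A).Realization) :
    IndepAt (Set.Ico (level p).1 half) (level p) p := (exists_indepAt p).choose_spec

lemma IndepAt.mono {S T : Set I} (h : S ⊆ T) {η : Level} {p : (ner.obj A).Realization}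
    (hp : IndepAt T η p) : IndepAt S η p := by
  obtain ⟨n, c, x, rfl⟩ := exists_nerPoint p
  exact Indep.mono h ((indepAt_nerPoint _ _ _ _).1 hp)

lemma IndepAt.singleton {η : Level} {p : (ner.obj A).Realization}
    (hp : IndepAt (Set.Ico η.1 half) η p) : IndepAt {η.1} η p :=
  hp.mono (by rintro _ rfl; exact ⟨le_rfl, η.2.2⟩)

lemma Indep.cubeArrow_eq_of_near {η : Level} {c : Box.Vert n ⥤ A} {x x' : Fin n.dim → I}
    (hc : Indep {η.1} η c x) (h : Near η x x') :
    cubeArrow c (threshold_half_le η x') =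
      cubeArrow c (h.threshold_half_le.trans (threshold_half_le η x)) :=
  (cubeArrow_trans_of_const (threshold_half_le η x') (hc.constOn_of_near h)).symm

/-- The open set on which the coordinates equal to `η` do not matter and lowering the threshold
to `η` leads to `b`. -/
def nbhd (η : Level) (b : A) : Opens (ner.obj A).Realization where
  carrier := {p | IndepAt {η.1} η p ∧ (stepArrow η p).right = b}
  is_open' := isOpen_realization fun n c x ⟨h, e⟩ => by
    rw [indepAt_nerPoint] at h
    filter_upwards [eventually_near η x] with x' hx'
    refine ⟨h.of_near hx', ?_⟩
    rw [stepArrow_nerPoint, h.cubeArrow_eq_of_near hx']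
    exact e

lemma mem_nbhd_level (p : (ner.obj A).Realization) : p ∈ nbhd (level p) (retractObj p) :=
  ⟨(indepAt_level p).singleton, congrArg Comma.right (indepAt_level p).stepArrow_eq⟩

/-- The relation in `U` is a chain of order intervals in cubes that map into `U`, and `Indep.of_le`
applies to each. Changing cubes along the chain is harmless since independence depends only on the
point. -/
lemma IndepAt.of_rel {η : Level} {U : Opens (ner.obj A).Realization}
    (hU : ∀ p ∈ U, IndepAt {η.1} η p) {p q : (ner.obj A).Realization}
    (h : (directedRealizationObj (ner.obj A)).circ.rel U p q)
    (hp : IndepAt (Set.Ico η.1 half) η p) : IndepAt (Set.Ico η.1 half) η q := by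
  obtain ⟨-, h⟩ := h
  induction h with
  | refl => exact hp
  | tail _ h ih =>
    obtain ⟨⟨n, c⟩, x, y, ⟨-, h⟩, rfl, rfl⟩ := h
    clear hp
    induction h with
    | refl => exact ih
    | tail _ h ih' =>
      exact Indep.of_le (A := A) (c := c) h.1 (fun z hz => hU _ (h.2 hz)) ih'

/-- The step arrow at `x'` factors as the drop between the midpoint roundings of `x'` and `x`,
followed by the step arrow at `x`. The first factor does not involve `η`, which makes different
levels comparable. -/
lemma preRel_near {a : A} {η : Level} {c : Box.Vert n ⥤ A} {x x' : Fin n.dim → I}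
    (hc : Indep {η.1} η c x) (h : Near η x x') (y y' : Σ b : A, (b ⟶ a)) :
    PreRel a (stepArrow η (nerPoint c x')) y y' ↔
      ∃ r, PreRel a (stepArrow η (nerPoint c x)) y r ∧
        PreRel a (cubeArrow c h.threshold_half_le) r y' := by
  rw [stepArrow_nerPoint, hc.cubeArrow_eq_of_near h, stepArrow_nerPoint]
  have e : homOfLE (h.threshold_half_le.trans (threshold_half_le η x)) =
    homOfLE h.threshold_half_le ≫ homOfLE (threshold_half_le η x) := rfl
  unfold cubeArrow
  rw [e, c.map_comp]
  exact preRel_comp _ _ _ _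

/-- Continuations computed with two levels agree locally if they agree at one point. -/
lemma eventually_preRel_iff {a : A} {η η' : Level} {p : (ner.obj A).Realization}
    (h : IndepAt {η.1} η p) (h' : IndepAt {η'.1} η' p) {y z r : Σ b : A, (b ⟶ a)}
    (hy : PreRel a (stepArrow η p) y r) (hz : PreRel a (stepArrow η' p) z r) :
    ∀ᶠ q in 𝓝 p, ∀ y', PreRel a (stepArrow η q) y y' ↔ PreRel a (stepArrow η' q) z y' := by
  have hE : IsOpen {q : (ner.obj A).Realization | IndepAt {η.1} η q ∧ IndepAt {η'.1} η' q ∧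
      ∃ r, PreRel a (stepArrow η q) y r ∧ PreRel a (stepArrow η' q) z r} := by
    refine isOpen_realization ?_
    rintro n c x ⟨h, h', r, hy, hz⟩
    rw [indepAt_nerPoint] at h h'
    filter_upwards [eventually_near η x, eventually_near η' x] with x' hx hx'
    obtain ⟨r', -, hr'⟩ := exists_preRel (a := a) (y := r)
      (g := cubeArrow c hx.threshold_half_le) (by
        obtain ⟨_, -, rfl⟩ := hy
        rfl)
    exact ⟨h.of_near hx, h'.of_near hx', r', (preRel_near h hx _ _).2 ⟨r, hy, hr'⟩,
      (preRel_near h' hx' _ _).2 ⟨r, hz, hr'⟩⟩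
  filter_upwards [hE.mem_nhds ⟨h, h', r, hy, hz⟩] with q ⟨_, _, r', hr₁, hr₂⟩ y'
  exact ⟨fun hh => hh.functional hr₁ ▸ hr₂, fun hh => hh.functional hr₂ ▸ hr₁⟩

/-! #### Transport along singular cubes -/

/-- The underlying continuous function of a singular cube of `|ner A|`. -/
def singPoint (γ : SingCube (directedRealizationObj (ner.obj A)) n) :
    C(Fin n.dim → I, (ner.obj A).Realization) := γ.toFun

/-- Here it matters that `γ` is a stream map: `t ≤ s` becomes a relation inside the neighbourhood,
along which independence propagates and forces the step arrow to be an identity. -/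
lemma indepAt_singPoint (γ : SingCube (directedRealizationObj (ner.obj A)) n) {η : Level} {b : A}
    {t s : Fin n.dim → I} (hts : t ≤ s) (h : Set.Icc t s ⊆ singPoint γ ⁻¹' nbhd η b)
    (ht : IndepAt (Set.Ico η.1 half) η (singPoint γ t)) :
    stepArrow η (singPoint γ s) = Arrow.mk (𝟙 (retractObj (singPoint γ s))) ∧
      retractObj (singPoint γ s) = b := by
  have := (IndepAt.of_rel (U := nbhd η b) (fun p hp => hp.1)
    (γ.map_rel _ t s hts h) ht).stepArrow_eq
  exact ⟨this, (congrArg Comma.right this).symm.trans (h ⟨hts, le_rfl⟩).2⟩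

/-- The continuation of morphisms with target `a` along a singular cube of `|ner A|`. -/
noncomputable def singContinuation (γ : SingCube (directedRealizationObj (ner.obj A)) n) (a : A) :
    LocalContinuation n.dim (Σ b : A, (b ⟶ a)) where
  fiber t := {y | y.1 = retractObj (singPoint γ t)}
  dom t := singPoint γ ⁻¹' nbhd (level (singPoint γ t)) (retractObj (singPoint γ t))
  cont t s := PreRel a (stepArrow (level (singPoint γ t)) (singPoint γ s))
  isOpen_dom t := (nbhd _ _).isOpen.preimage (singPoint γ).continuous
  mem_dom t := mem_nbhd_level _
  functional h h' := h.functional h'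
  exists_cont {t s y} hs hy := by
    obtain ⟨y', h, h'⟩ := exists_preRel (Eq.trans hy hs.2.symm)
    exact ⟨y', h.trans (stepArrow_left _ _), h'⟩
  coherent {t s y z} hs hy hz := by
    have hz' : z.1 = retractObj (singPoint γ s) := by
      obtain ⟨_, -, rfl⟩ := hz
      exact stepArrow_left _ _
    -- At `s` itself, the level of `t` leads from `y` to `z` and the level of `s` keeps `z`. The two
    -- continuations agree at `s`, hence nearby.
    refine (singPoint γ).continuous.continuousAt.eventually (eventually_preRel_iff hs.1
      (indepAt_level _).singleton hz ?_)
    rw [(indepAt_level _).stepArrow_eq]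
    exact preRel_id hz'
  fiber_eq {t s} hts h := by
    rw [(indepAt_singPoint γ hts h (indepAt_level _)).2]
  cont_self {t s y} hts h hy := by
    obtain ⟨h₁, h₂⟩ := indepAt_singPoint γ hts h (indepAt_level _)
    rw [h₁]
    exact preRel_id (Eq.trans hy h₂.symm)

end Nerve

/-! ### Transport along singular cubes and its functoriality. -/

section Transport

variable {A B : Cat.{u, u}} {m n : Box}

/-- The function `|ner F|`. -/
def nerMapPoint (F : A ⟶ B) : C((ner.obj A).Realization, (ner.obj B).Realization) :=
  (directedRealizationMap (ner.map F)).toFun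

lemma nerMapPoint_nerPoint (F : A ⟶ B) (c : Box.Vert n ⥤ A) (x : Fin n.dim → I) :
    nerMapPoint F (nerPoint c x) = nerPoint (c ⋙ F.toFunctor) x := rfl

lemma retractObj_nerMapPoint (F : A ⟶ B) (p : (ner.obj A).Realization) :
    retractObj (nerMapPoint F p) = F.toFunctor.obj (retractObj p) := by
  obtain ⟨p⟩ := p
  rfl

lemma stepArrow_nerMapPoint (F : A ⟶ B) (η : Level) (p : (ner.obj A).Realization) :
    stepArrow η (nerMapPoint F p) = F.toFunctor.mapArrow.obj (stepArrow η p) := by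
  obtain ⟨p⟩ := p
  rfl

lemma ConstOn.comp {c : Box.Vert n ⥤ A} {u v : Box.Vert n} {h : u ≤ v} (hc : ConstOn c h)
    (F : A ⥤ B) : ConstOn (c ⋙ F) h :=
  (congrArg F.mapArrow.obj hc).trans (congrArg Arrow.mk (F.map_id _))

lemma IndepAt.map {S : Set I} {η : Level} {p : (ner.obj A).Realization} (h : IndepAt S η p)
    (F : A ⟶ B) : IndepAt S η (nerMapPoint F p) := by
  obtain ⟨n, c, x, rfl⟩ := exists_nerPoint p
  rw [nerMapPoint_nerPoint]
  exact fun u v huv hu hv hS => ((indepAt_nerPoint S η c x).1 h u v huv hu hv hS).comp F.toFunctor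

/-- Functors preserve step arrows of a given level; the level chosen at the image point may be
another one, but both continuations start from the same value and so agree nearby. The morphism `k`
serves to compose transports, the functor `F` to prove naturality. -/
lemma section_map (F : A ⟶ B) {γ : SingCube (directedRealizationObj (ner.obj A)) n}
    {γ' : SingCube (directedRealizationObj (ner.obj B)) n}
    (hγ : ∀ t, singPoint γ' t = nerMapPoint F (singPoint γ t)) {a : A} {b : B}
    (k : F.toFunctor.obj a ⟶ b) {R : Set (Fin n.dim → I)} {ρ : (Fin n.dim → I) → Σ b : A, (b ⟶ a)}
    (h : (singContinuation γ a).Section R ρ) :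
    (singContinuation γ' b).Section R fun t => sliceMap F.toFunctor k (ρ t) := by
  intro t ht
  have hfib : (ρ t).1 = retractObj (singPoint γ t) := (h t ht).1
  have hfib' : (sliceMap F.toFunctor k (ρ t)).1 = retractObj (singPoint γ' t) := by
    rw [hγ, retractObj_nerMapPoint, ← hfib]
    rfl
  refine ⟨hfib', ?_⟩
  have hI : IndepAt (Set.Ico (level (singPoint γ t)).1 half) (level (singPoint γ t))
      (singPoint γ' t) := by
    rw [hγ]
    exact (indepAt_level _).map F
  have key := (singPoint γ').continuous.continuousAt.eventually (eventually_preRel_iff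
    (a := b) (y := sliceMap F.toFunctor k (ρ t)) (z := sliceMap F.toFunctor k (ρ t))
    (r := sliceMap F.toFunctor k (ρ t)) hI.singleton
    (indepAt_level (singPoint γ' t)).singleton
    (by rw [hI.stepArrow_eq]; exact preRel_id hfib')
    (by rw [(indepAt_level _).stepArrow_eq]; exact preRel_id hfib'))
  filter_upwards [(h t ht).2, mem_nhdsWithin_of_mem_nhds key] with s hs hs'
  refine (hs' _).1 ?_
  rw [hγ s, stepArrow_nerMapPoint]
  exact hs.map F.toFunctor k

lemma section_precomp (φ : m ⟶ n) {γ : SingCube (directedRealizationObj (ner.obj A)) n} {a : A}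
    {R : Set (Fin n.dim → I)} {R' : Set (Fin m.dim → I)} (hR : Set.MapsTo (Box.eval φ I) R' R)
    {ρ : (Fin n.dim → I) → Σ b : A, (b ⟶ a)} (h : (singContinuation γ a).Section R ρ) :
    (singContinuation (γ.precomp φ) a).Section R' fun t => ρ (Box.eval φ I t) := by
  intro t ht
  refine ⟨(h _ (hR ht)).1, ?_⟩
  have hlim : Tendsto (Box.eval φ I) (𝓝[R'] t) (𝓝[R] (Box.eval φ I t)) :=
    ((continuous_eval φ).continuousWithinAt).tendsto_nhdsWithin hR
  exact hlim.eventually (h _ (hR ht)).2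

/-- The arrow `g` is obtained from the identity of its target by continuation along a singular
cube `γ` from `t` down to `s`. -/
def IsTransport (γ : SingCube (directedRealizationObj (ner.obj A)) n) (s t : Fin n.dim → I)
    (g : Arrow A) : Prop :=
  ∃ ρ, (singContinuation γ g.right).Section (Set.Icc s t) ρ ∧ ρ t = ⟨g.right, 𝟙 g.right⟩ ∧
    ρ s = ⟨g.left, g.hom⟩

variable {γ : SingCube (directedRealizationObj (ner.obj A)) n} {s t r : Fin n.dim → I}

lemma IsTransport.right_eq {g : Arrow A} (hst : s ≤ t) (h : IsTransport γ s t g) :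
    g.right = retractObj (singPoint γ t) := by
  obtain ⟨ρ, hρ, e, -⟩ := h
  have : (ρ t).1 = retractObj (singPoint γ t) := (hρ t ⟨hst, le_rfl⟩).1
  rwa [e] at this

lemma IsTransport.unique {g g' : Arrow A} (hst : s ≤ t) (h : IsTransport γ s t g)
    (h' : IsTransport γ s t g') : g = g' := by
  have e := (h.right_eq hst).trans (h'.right_eq hst).symm
  obtain ⟨x, y, f⟩ := g
  obtain ⟨x', y', f'⟩ := g'
  obtain rfl : y = y' := e
  obtain ⟨ρ, hρ, e₁, e₂⟩ := h
  obtain ⟨ρ', hρ', e₁', e₂'⟩ := h'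
  have := hρ.eq_of_eq_top hρ' (e₁.trans e₁'.symm) s ⟨le_rfl, hst⟩
  have := e₂.symm.trans (this.trans e₂')
  obtain ⟨rfl, e⟩ := Sigma.mk.inj this
  obtain rfl := eq_of_heq e
  rfl

lemma exists_isTransport (γ : SingCube (directedRealizationObj (ner.obj A)) n) (hst : s ≤ t) :
    ∃ f : retractObj (singPoint γ s) ⟶ retractObj (singPoint γ t),
      IsTransport γ s t (Arrow.mk f) := by
  obtain ⟨ρ, hρ, e⟩ := (singContinuation γ (retractObj (singPoint γ t))).extends_all hst
    ⟨_, 𝟙 _⟩ rfl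
  have h : (ρ s).1 = retractObj (singPoint γ s) := (hρ s ⟨le_rfl, hst⟩).1
  obtain ⟨f, hf⟩ : ∃ f, ρ s = ⟨retractObj (singPoint γ s), f⟩ := by
    rw [← h]
    exact ⟨_, rfl⟩
  exact ⟨f, ρ, hρ, e, hf⟩

lemma isTransport_id (γ : SingCube (directedRealizationObj (ner.obj A)) n) (t : Fin n.dim → I) :
    IsTransport γ t t (Arrow.mk (𝟙 (retractObj (singPoint γ t)))) := by
  obtain ⟨f, ρ, hρ, e, -⟩ := exists_isTransport γ (le_refl t)
  exact ⟨ρ, hρ, e, e⟩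

lemma nerMapPoint_id (p : (ner.obj A).Realization) : nerMapPoint (𝟙 A) p = p := by
  obtain ⟨p⟩ := p
  rfl

/-- The section starting from `𝟙 z` reaches `g` at `t`. Below `t` it must be the section of `f`
postcomposed with `g`, by uniqueness from the top. -/
lemma IsTransport.comp {x y z : A} {f : x ⟶ y} {g : y ⟶ z} (hst : s ≤ t) (htr : t ≤ r)
    (hf : IsTransport γ s t (Arrow.mk f)) (hg : IsTransport γ t r (Arrow.mk g)) :
    IsTransport γ s r (Arrow.mk (f ≫ g)) := by
  obtain ⟨ρ₁, h₁, e₁, e₁'⟩ := hf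
  obtain ⟨ρ₂, h₂, e₂, e₂'⟩ := hg
  have hz : z = retractObj (singPoint γ r) := IsTransport.right_eq htr ⟨ρ₂, h₂, e₂, e₂'⟩
  obtain ⟨ρ, h, e⟩ := (singContinuation γ z).extends_all (hst.trans htr) ⟨z, 𝟙 z⟩ hz
  refine ⟨ρ, h, e, ?_⟩
  have ht := (h.mono (Set.Icc_subset_Icc_left hst)).eq_of_eq_top h₂ (e.trans e₂.symm) t
    ⟨le_rfl, htr⟩
  have h₃ := section_map (𝟙 A) (γ' := γ) (fun t => (nerMapPoint_id _).symm) (b := z) g h₁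
  have hs := (h.mono (Set.Icc_subset_Icc_right htr)).eq_of_eq_top h₃ (by
    rw [ht, e₂', e₁]
    exact Sigma.ext rfl (heq_of_eq (Category.id_comp g).symm)) s ⟨le_rfl, hst⟩
  rw [hs, e₁']
  rfl

lemma IsTransport.map (F : A ⟶ B) {γ' : SingCube (directedRealizationObj (ner.obj B)) n}
    (hγ : ∀ t, singPoint γ' t = nerMapPoint F (singPoint γ t)) {g : Arrow A}
    (h : IsTransport γ s t g) : IsTransport γ' s t (F.toFunctor.mapArrow.obj g) := by
  obtain ⟨ρ, hρ, e, e'⟩ := h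
  refine ⟨_, section_map F hγ (b := F.toFunctor.obj g.right) (𝟙 _) hρ, ?_, ?_⟩
  · rw [e]
    refine Sigma.ext rfl (heq_of_eq ?_)
    change F.toFunctor.map (𝟙 _) ≫ 𝟙 _ = 𝟙 _
    rw [F.toFunctor.map_id, Category.comp_id]
  · rw [e']
    exact Sigma.ext rfl (heq_of_eq (Category.comp_id _))

lemma IsTransport.precomp (φ : m ⟶ n) {s t : Fin m.dim → I} {g : Arrow A}
    (h : IsTransport γ (Box.eval φ I s) (Box.eval φ I t) g) :
    IsTransport (γ.precomp φ) s t g := by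
  obtain ⟨ρ, hρ, e, e'⟩ := h
  exact ⟨_, section_precomp φ (R' := Set.Icc s t) (R := Set.Icc (Box.eval φ I s) (Box.eval φ I t))
    (fun x hx => ⟨Box.eval_mono I φ hx.1, Box.eval_mono I φ hx.2⟩) hρ,
    e, e'⟩

lemma threshold_mono (η : I) {x x' : Fin n.dim → I} (h : x ≤ x') :
    threshold η x ≤ threshold η x' :=
  vert_le_iff.2 fun j hj => by
    rw [threshold_apply] at hj ⊢
    exact hj.trans (h j)

lemma isTransport_charMap (c : Box.Vert n ⥤ A)
    {γ : SingCube (directedRealizationObj (ner.obj A)) n}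
    (hγ : ∀ x, singPoint γ x = nerPoint c x) (hst : s ≤ t) :
    IsTransport γ s t (cubeArrow c (threshold_mono half hst)) := by
  classical
  -- The section is explicit: the image under `c` of the comparison of roundings. The identity is a
  -- default value off the region `x ≤ t`, where nothing is tested.
  let ρ : (Fin n.dim → I) → Σ b : A, (b ⟶ c.obj (threshold half t)) := fun x =>
    if h : x ≤ t then ⟨c.obj (threshold half x), c.map (homOfLE (threshold_mono half h))⟩
    else ⟨_, 𝟙 _⟩
  have hρ (x) (h : x ≤ t) :
      ρ x = ⟨c.obj (threshold half x), c.map (homOfLE (threshold_mono half h))⟩ := dif_pos h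
  refine ⟨ρ, ?_, ?_, hρ s hst⟩
  · intro x hx
    have hfib : (ρ x).1 = retractObj (singPoint γ x) := by
      rw [hγ, hρ x hx.2]
      rfl
    refine ⟨hfib, ?_⟩
    have hI := indepAt_level (singPoint γ x)
    have hI' := hI.singleton
    have hid := hI.stepArrow_eq
    change ∀ᶠ x' in _, PreRel _ (stepArrow (level (singPoint γ x)) (singPoint γ x')) _ _
    -- Only the independence at this level matters; it is made a variable so that rewriting the
    -- point does not change it.
    generalize level (singPoint γ x) = η at hI hI' hid
    rw [hγ] at hI' hid hfib
    filter_upwards [mem_nhdsWithin_of_mem_nhds (eventually_near η x), self_mem_nhdsWithin]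
      with x' hx' hx'R
    rw [hγ]
    refine (preRel_near ((indepAt_nerPoint _ _ _ _).1 hI') hx' _ _).2 ⟨ρ x, ?_, ?_⟩
    · rw [hid]
      exact preRel_id hfib
    · refine ⟨c.map (homOfLE (threshold_mono half hx.2)), hρ x hx.2, ?_⟩
      rw [hρ x' hx'R.2]
      refine Sigma.ext rfl (heq_of_eq ?_)
      exact c.map_comp (homOfLE hx'.threshold_half_le) (homOfLE (threshold_mono half hx.2))
  · rw [hρ t le_rfl]
    exact Sigma.ext rfl (heq_of_eq (c.map_id _))

/-! #### The retraction of singular cubes onto the nerve -/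

/-- A vertex of `[1]ⁿ` as a point of the cube. -/
def vertPoint (v : Box.Vert n) : Fin n.dim → I := fun j => if v j then ⊤ else ⊥

lemma vertPoint_mono {u v : Box.Vert n} (h : u ≤ v) : vertPoint u ≤ vertPoint v := by
  intro j
  have := vert_le_iff.1 h j
  unfold vertPoint
  split_ifs with h₁ h₂
  · exact le_rfl
  · exact absurd (this h₁) h₂
  · exact bot_le
  · exact le_rfl

lemma eval_vertPoint (φ : m ⟶ n) (v : Box.Vert m) :
    Box.eval φ I (vertPoint v) = vertPoint (n := n) (Box.eval φ Bool v) := by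
  funext j
  unfold vertPoint Box.eval
  rcases φ.coord j with i | b
  · rfl
  · cases b <;> rfl

lemma threshold_vertPoint (v : Box.Vert n) : threshold half (vertPoint v) = v := by
  funext j
  refine Bool.eq_iff_iff.2 ?_
  rw [threshold_apply]
  unfold vertPoint
  split_ifs with h
  · exact ⟨fun _ => h, fun _ => le_top⟩
  · exact ⟨fun h' => absurd h' half_pos.not_ge, fun h' => absurd h' h⟩

/-- The `n`-cube of `ner A` obtained from a singular cube of `|ner A|` by transport. -/
noncomputable def singRetract (γ : SingCube (directedRealizationObj (ner.obj A)) n) :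
    Box.Vert n ⥤ A where
  obj v := retractObj (singPoint γ (vertPoint v))
  map f := (exists_isTransport γ (vertPoint_mono (leOfHom f))).choose
  map_id v := by
    have h := (exists_isTransport γ (vertPoint_mono (leOfHom (𝟙 v)))).choose_spec
    exact Arrow.mk_injective _ _ (h.unique le_rfl (isTransport_id γ _))
  map_comp {u v w} f g := by
    have h := (exists_isTransport γ (vertPoint_mono (leOfHom (f ≫ g)))).choose_spec
    exact Arrow.mk_injective _ _ (h.unique (vertPoint_mono (leOfHom (f ≫ g)))
      (IsTransport.comp (vertPoint_mono (leOfHom f)) (vertPoint_mono (leOfHom g))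
        (exists_isTransport γ (vertPoint_mono (leOfHom f))).choose_spec
        (exists_isTransport γ (vertPoint_mono (leOfHom g))).choose_spec))

lemma isTransport_singRetract (γ : SingCube (directedRealizationObj (ner.obj A)) n)
    {u v : Box.Vert n} (h : u ≤ v) :
    IsTransport γ (vertPoint u) (vertPoint v) (cubeArrow (singRetract γ) h) :=
  (exists_isTransport γ (vertPoint_mono h)).choose_spec

/-- Singular cubes of `|ner A|` retract onto functors characterized by transport. -/
lemma singRetract_eq {γ : SingCube (directedRealizationObj (ner.obj A)) n} (c : Box.Vert n ⥤ A)
    (h : ∀ {u v : Box.Vert n} (h : u ≤ v),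
      IsTransport γ (vertPoint u) (vertPoint v) (cubeArrow c h)) : singRetract γ = c := by
  have e {u v : Box.Vert n} (huv : u ≤ v) : cubeArrow (singRetract γ) huv = cubeArrow c huv :=
    (isTransport_singRetract γ huv).unique (vertPoint_mono huv) (h huv)
  exact vertFunctor_ext _ _ (fun w => congrArg Comma.left (e (le_refl w))) fun w i => e _

/-- The retraction `sing |ner A| ⟶ ner A`. -/
noncomputable def nerRetraction : ner.{u} ⋙ directedRealization ⋙ sing ⟶ ner where
  app A :=
    { app := fun n => TypeCat.ofHom fun γ : SingCube (directedRealizationObj (ner.obj A)) n.unop =>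
        singRetract γ
      naturality := fun m n φ => by
        ext γ
        refine singRetract_eq (γ := SingCube.precomp φ.unop γ)
          (Box.evalFunctor φ.unop ⋙ singRetract γ) fun {u v} h => ?_
        refine IsTransport.precomp φ.unop ?_
        rw [eval_vertPoint, eval_vertPoint]
        exact isTransport_singRetract γ (Box.eval_mono Bool φ.unop h) }
  naturality A B F := by
    ext n γ
    refine singRetract_eq (γ := SingCube.postcomp (directedRealization.map (ner.map F)) γ)
      (singRetract γ ⋙ F.toFunctor) fun {u v} h => ?_
    exact (isTransport_singRetract γ h).map F fun _ => rfl

lemma singUnit_nerRetraction :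
    Functor.whiskerLeft ner.{u} singUnit ≫ nerRetraction = 𝟙 ner.{u} := by
  ext A n c
  refine singRetract_eq (A := A) c fun {u v} h => ?_
  rw [cubeArrow_congr c h (threshold_mono half (vertPoint_mono h)) (threshold_vertPoint u).symm
    (threshold_vertPoint v).symm]
  exact isTransport_charMap c (fun _ => rfl) (vertPoint_mono h)

end Transport

/-! ### Comparison of the equivalences -/

section NaturalRetract

variable {C D : Type*} [Category C] [Category D] {T : C ⥤ D} {N : D ⥤ C} (adj : T ⊣ N)
  {S : C ⥤ C} (u : 𝟭 C ⟶ S) (β : N ⋙ S ⟶ N)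

/-- If `S` is augmented and retracts onto the identity on the image of a right adjoint `N`, then
the left adjoint `T` is a retract of `S ⋙ T`. -/
def adjunctRetraction : S ⋙ T ⟶ T where
  app X := T.map (S.map (adj.unit.app X) ≫ β.app (T.obj X)) ≫ adj.counit.app (T.obj X)
  naturality X Y f := by
    have h₁ := β.naturality (T.map f)
    have h₂ := adj.counit.naturality (T.map f)
    have h₃ := adj.unit.naturality f
    dsimp at h₁ h₂ h₃ ⊢
    rw [Category.assoc, ← h₂, ← T.map_comp_assoc, ← T.map_comp_assoc, Category.assoc, ← h₁,
      ← S.map_comp_assoc, ← S.map_comp_assoc, h₃]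

lemma map_adjunctRetraction (hβ : ∀ A, u.app (N.obj A) ≫ β.app A = 𝟙 (N.obj A)) (X : C) :
    T.map (u.app X) ≫ (adjunctRetraction adj β).app X = 𝟙 (T.obj X) := by
  have h := u.naturality (adj.unit.app X)
  dsimp [adjunctRetraction] at h ⊢
  rw [← T.map_comp_assoc, ← Category.assoc, ← h, Category.assoc, hβ, Category.comp_id,
    adj.left_triangle_components]

/-- The natural retraction of `S ⋙ T` onto `T`, on morphisms of diagrams. -/
def adjunctRetractArrow (hβ : ∀ A, u.app (N.obj A) ≫ β.app A = 𝟙 (N.obj A)) {G : Type*}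
    [Category G] {X Y : G ⥤ C} (f : X ⟶ Y) :
    RetractArrow (((Functor.whiskeringRight G C D).obj T).map f)
      (((Functor.whiskeringRight G C D).obj T).map
        (((Functor.whiskeringRight G C C).obj S).map f)) where
  i := Arrow.homMk
    { app := fun i => T.map (u.app (X.obj i))
      naturality := fun i j g => by
        have := u.naturality (X.map g)
        dsimp at this ⊢
        rw [← T.map_comp, ← T.map_comp, this] }
    { app := fun i => T.map (u.app (Y.obj i))
      naturality := fun i j g => by
        have := u.naturality (Y.map g)
        dsimp at this ⊢
        rw [← T.map_comp, ← T.map_comp, this] }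
    (by
      ext i
      have := u.naturality (f.app i)
      dsimp at this ⊢
      rw [← T.map_comp, ← T.map_comp, this])
  r := Arrow.homMk (Functor.whiskerLeft X (adjunctRetraction adj β))
    (Functor.whiskerLeft Y (adjunctRetraction adj β)) (by
      ext i
      exact ((adjunctRetraction adj β).naturality (f.app i)).symm)
  retract := by
    ext i
    · exact map_adjunctRetraction adj u β hβ (X.obj i)
    · exact map_adjunctRetraction adj u β hβ (Y.obj i)

end NaturalRetract

/-! ### Preservation and reflection of equivalences of `G`-diagrams. -/

section

variable (G : Type u) [SmallCategory G]

lemma catEquivalences_eq_inverseImage :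
    catEquivalences G = (MorphismProperty.isomorphisms _).inverseImage (dCatQuotient G) :=
  zigZagEquivalences_eq_inverseImage (catCylinder.diagram G).Homotopic

/-- The equivalences are the morphisms inverted by the quotient functor, and isomorphisms are stable
under retracts. -/
instance : (catEquivalences G).IsStableUnderRetracts := by
  rw [catEquivalences_eq_inverseImage]
  infer_instance

lemma catEquivalences_le_cubicalEquivalences :
    catEquivalences G ≤ (cubicalEquivalences G).inverseImage (nerDiagram G) :=
  fun _ _ _ h => zigZagEquivalences.map (nerDiagram G) (ner_homotopic G) h

lemma cubicalEquivalences_le_directedEquivalences :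
    cubicalEquivalences G ≤ directedEquivalences G :=
  fun _ _ _ h =>
    zigZagEquivalences.map (directedRealizationDiagram G) (directedRealization_homotopic G) h

instance nerDiagram_full : (nerDiagram G).Full :=
  inferInstanceAs ((Functor.whiskeringRight G _ _).obj ner).Full

instance nerDiagram_faithful : (nerDiagram G).Faithful :=
  inferInstanceAs ((Functor.whiskeringRight G _ _).obj ner).Faithful

variable {G}

lemma cubicalEquivalences_le_catEquivalences {T : CubicalSet.{u} ⥤ Cat.{u, u}} (adj : T ⊣ ner) :
    cubicalEquivalences G ≤
      (catEquivalences G).inverseImage ((Functor.whiskeringRight G _ _).obj T) :=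
  fun _ _ _ h => zigZagEquivalences.map _ (catHomotopic_of_adjunction adj G) h

/-- Singular cubes turn the directed equivalence `|ψ|` into a cubical one, which `T` carries to an
equivalence; `T ψ` is a retract of the latter because nerves are natural retracts of their singular
cubical sets. -/
lemma directedEquivalences_le_catEquivalences {T : CubicalSet.{u} ⥤ Cat.{u, u}} (adj : T ⊣ ner) :
    directedEquivalences G ≤
      (catEquivalences G).inverseImage ((Functor.whiskeringRight G _ _).obj T) := by
  intro X Y ψ h
  have h' : cubicalEquivalences G (((Functor.whiskeringRight G _ _).obj
      (directedRealization ⋙ sing)).map ψ) :=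
    zigZagEquivalences.map ((Functor.whiskeringRight G _ _).obj sing) (sing_homotopic G) h
  exact MorphismProperty.of_retract (P := catEquivalences G)
    (adjunctRetractArrow adj singUnit nerRetraction
    (fun A => NatTrans.congr_app singUnit_nerRetraction A) ψ)
    (cubicalEquivalences_le_catEquivalences adj _ h')

/-- The counit is invertible since the nerve is fully faithful, so `F` is isomorphic to `T (ner F)`
as an arrow. -/
lemma catEquivalences_of_nerDiagram {T : (G ⥤ CubicalSet.{u}) ⥤ (G ⥤ Cat.{u, u})}
    (adj : T ⊣ nerDiagram G)
    (hT : directedEquivalences G ≤ (catEquivalences G).inverseImage T) {A B : G ⥤ Cat.{u, u}}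
    (F : A ⟶ B) (h : directedEquivalences G ((nerDiagram G).map F)) : catEquivalences G F := by
  refine (MorphismProperty.arrow_mk_iso_iff (catEquivalences G) (Arrow.isoMk
    (asIso (adj.counit.app A)) (asIso (adj.counit.app B)) ?_)).1 (hT _ h)
  exact (adj.counit.naturality F).symm

end

end DirHtpy

open DirHtpy in
theorem mainTheorem2 (G : Type u) [SmallCategory G] :
    (DirHtpy.dCatQuotient G).IsLocalization (DirHtpy.catEquivalences G) ∧
    (∀ (D : Type w) [Category.{v} D] (L : (G ⥤ DirHtpy.CubicalSet.{u}) ⥤ D)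
      [L.IsLocalization (DirHtpy.directedEquivalences G)],
      ∃ E : DirHtpy.dCat G ⥤ D, E.Full ∧ E.Faithful ∧
        Nonempty (DirHtpy.dCatQuotient G ⋙ E ≅ DirHtpy.nerDiagram G ⋙ L)) ∧
    (∀ (D : Type w) [Category.{v} D] (L : (G ⥤ DirHtpy.CubicalSet.{u}) ⥤ D)
      [L.IsLocalization (DirHtpy.cubicalEquivalences G)],
      ∃ E : DirHtpy.dCat G ⥤ D, E.Full ∧ E.Faithful ∧
        Nonempty (DirHtpy.dCatQuotient G ⋙ E ≅ DirHtpy.nerDiagram G ⋙ L)) ∧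
    (∀ (A B : G ⥤ Cat.{u, u}) (F : A ⟶ B), DirHtpy.catEquivalences G F ↔
      DirHtpy.streamEquivalences G
        ((DirHtpy.directedRealizationDiagram G).map ((DirHtpy.nerDiagram G).map F))) := by
  have adj := Adjunction.ofIsRightAdjoint ner.{u}
  have adjG : (Functor.whiskeringRight G _ _).obj _ ⊣ nerDiagram G := adj.whiskerRight G
  have hq := isLocalization_dCatQuotient G
  have hner : catEquivalences G ≤ (directedEquivalences G).inverseImage (nerDiagram G) :=
    fun _ _ f h => cubicalEquivalences_le_directedEquivalences G _
      (catEquivalences_le_cubicalEquivalences G f h)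
  exact ⟨hq,
    fun D _ L _ => exists_fullyFaithful_of_adjunction adjG L (directedEquivalences G)
      (dCatQuotient G) (catEquivalences G) (directedEquivalences_le_catEquivalences adj) hner,
    fun D _ L _ => exists_fullyFaithful_of_adjunction adjG L (cubicalEquivalences G)
      (dCatQuotient G) (catEquivalences G) (cubicalEquivalences_le_catEquivalences adj)
      (catEquivalences_le_cubicalEquivalences G),
    fun A B F => ⟨fun h => hner F h, fun h => catEquivalences_of_nerDiagram adjG
      (directedEquivalences_le_catEquivalences adj) F h⟩⟩
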